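/- Let $d \ge 2$. For a set $E \subseteq \mathbb R^d$ write $\Delta(E) = \{|x-y| : x,y \in E\}$ for its (Euclidean) distance set. For a Borel probability measure $\mu$ on $\mathbb R^d$ put $\widehat\mu(\xi) = \int e^{-i x\cdot \xi}\,d\mu(x)$ and $\mathbb F_\mu(T) = \int_{|\xi| \le T} |\widehat\mu(\xi)|^2\,d\xi$. The measure $\mu$ is called locally uniformly $s$-dimensional if there is $C>0$ such that $\mu(Q) \le C\,\ell(Q)^s$ for all axis-parallel cubes $Q \subseteq [0,1]^d$ with side length $\ell(Q)$. With $\mathbb H^s$ denoting $s$-dimensional Hausdorff measure, a set $E \subseteq [0,1]^d$ of Hausdorff dimension $s$ is called quasi-regular if there is $\kappa>0$ such that $$\liminf_{r \to 0} \frac{\mathbb H^s(E \cap B(x;r))}{(2r)^s} \ge \kappa \quad \text{for } \mathbb H^s\text{-almost every } x \in E .$$ For $0 < \tau_1 \le \tau_2 < 1$, a finite or infinite sequence $t_1, t_2, \ldots$ in $(0,1]$ is called $(\tau_1,\tau_2)$-lacunary if $\tau_1 \le t_{j+1}/t_j \le \tau_2$ for all pairs of consecutive terms. Theorem. Given $d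 \ge 2$, $C_0 \ge 1$ and $0 < \tau_1 \le \tau_2 < 1$, there exist $\varepsilon_0 \in (0,1)$ and an integer $J_0 \ge 1$, depending only on $d, C_0, \tau_1, \tau_2$, with the following property. Let $s \in (d-\varepsilon_0, d)$, let $E \subseteq [0,1]^d$ be a quasi-regular Borel set of Hausdorff dimension $s$, and let $\mu$ be a locally uniformly $s$-dimensional Borel probability measure with $\mu(E)=1$ and $$C_0^{-1} T^{d-s} \le \mathbb F_\mu(T) \le C_0 T^{d-s} \quad \text{for all } T \ge 1 .$$ Then every $(\tau_1,\tau_2)$-lacunary sequence $t_1, \ldots, t_{J_0}$ in $(0,1]$ satisfies $\#\bigl(\Delta(E) \cap \{t_1, \ldots, t_{J_0}\}\bigr) \ge 1$. In particular, if $(t_j)_{j \ge 1}$ is an infinite $(\tau_1,\tau_2)$-lacunary sequence, then for every integer $k \ge 0$ the block $\{k+1, \ldots, k+J_0\}$ contains an index $j$ with $t_j \in \Delta(E)$. -/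

import Mathlib

open MeasureTheory Filter Topology

/-- The unit cube `[0,1]^d` in Euclidean space. -/
def unitCube (d : ℕ) : Set (EuclideanSpace ℝ (Fin d)) :=
  {x | ∀ i, x i ∈ Set.Icc (0 : ℝ) 1}

/-- The closed axis-parallel cube `c + ℓ[0,1]^d` with smallest vertex `c` and side length `ℓ`. -/
def axisCube {d : ℕ} (c : EuclideanSpace ℝ (Fin d)) (l : ℝ) : Set (EuclideanSpace ℝ (Fin d)) :=
  {x | ∀ i, x i ∈ Set.Icc (c i) (c i + l)}

/-- The distance set `Δ(E) = {|x - y| : x, y ∈ E}` (Euclidean norm). -/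
def distanceSet {d : ℕ} (E : Set (EuclideanSpace ℝ (Fin d))) : Set ℝ :=
  {r | ∃ x ∈ E, ∃ y ∈ E, ‖x - y‖ = r}

/-- The Fourier transform of a measure, `μ̂(ξ) = ∫ e^{-i x·ξ} dμ(x)`. -/
noncomputable def fourierMeasure {d : ℕ} (μ : Measure (EuclideanSpace ℝ (Fin d)))
    (ξ : EuclideanSpace ℝ (Fin d)) : ℂ :=
  ∫ x, Complex.exp (-(Complex.I * ((inner ℝ x ξ : ℝ) : ℂ))) ∂μ

/-- The partial `L²`-Fourier integral `F_μ(T) = ∫_{|ξ| ≤ T} |μ̂(ξ)|² dξ`. -/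
noncomputable def partialFourierIntegral {d : ℕ} (μ : Measure (EuclideanSpace ℝ (Fin d)))
    (T : ℝ) : ℝ :=
  ∫ ξ in Metric.closedBall (0 : EuclideanSpace ℝ (Fin d)) T, ‖fourierMeasure μ ξ‖ ^ 2

/-- `μ` is locally uniformly `s`-dimensional: `μ(Q) ≤ C ℓ(Q)^s` for all cubes `Q ⊆ [0,1]^d`. -/
def IsLocallyUniformlyDimensional {d : ℕ} (s : ℝ) (μ : Measure (EuclideanSpace ℝ (Fin d))) :
    Prop :=
  ∃ C : ℝ, 0 < C ∧ ∀ (c : EuclideanSpace ℝ (Fin d)) (l : ℝ), 0 < l →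
    axisCube c l ⊆ unitCube d → μ (axisCube c l) ≤ ENNReal.ofReal (C * l ^ s)

/-- `E` is an `s`-dimensional quasi-regular set: it has Hausdorff dimension `s`, and for some
`κ > 0` the lower `s`-density of `E` is at least `κ` at `H^s`-almost every point of `E`. -/
def IsQuasiRegular {d : ℕ} (s : ℝ) (E : Set (EuclideanSpace ℝ (Fin d))) : Prop :=
  dimH E = ENNReal.ofReal s ∧
    ∃ κ : ℝ, 0 < κ ∧
      ∀ᵐ x ∂((Measure.hausdorffMeasure s : Measure (EuclideanSpace ℝ (Fin d))).restrict E),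
        ENNReal.ofReal κ ≤
          liminf (fun r : ℝ =>
            Measure.hausdorffMeasure s (E ∩ Metric.ball x r) / ENNReal.ofReal ((2 * r) ^ s))
            (𝓝[>] (0 : ℝ))

/-- `t_1, t_2, …` is a `(τ₁, τ₂)`-lacunary sequence of length `N` (infinite if `N = ⊤`): the terms
`t_j` with `1 ≤ j ≤ N` lie in `(0, 1]`, and consecutive terms among them have ratio in `[τ₁, τ₂]`.
The other values of `t` are irrelevant. -/
def IsLacunary (τ₁ τ₂ : ℝ) (N : ℕ∞) (t : ℕ → ℝ) : Prop :=
  (∀ j : ℕ, 1 ≤ j → (j : ℕ∞) ≤ N → t j ∈ Set.Ioc (0 : ℝ) 1) ∧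
    ∀ j : ℕ, 1 ≤ j → ((j + 1 : ℕ) : ℕ∞) ≤ N →
      τ₁ ≤ t (j + 1) / t j ∧ t (j + 1) / t j ≤ τ₂

/-! Fix a probability measure `σ` on the unit sphere with `|σ̂(ξ)| ≤ B|ξ|^(-1/3)`
(`exists_sphere_measure_charFun_decay`). For independent `x, y` of law `μ` and `ω` of law `σ`, the
variable `x - y + tω` has characteristic function `|μ̂(ξ)|² σ̂(tξ)`. If `t` is not a distance of a
compact set carrying `μ`, this variable stays away from `0`, so its density at `0` vanishes: the
integral of `|μ̂(ξ)|² Re σ̂(tξ)`, regularised by a Gaussian, tends to `0`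
(`tendsto_integral_norm_charFun_sq_mul_gaussian`).

That integral is bounded below by splitting frequencies at `1/t` and `M/t`. Low frequencies
contribute a positive multiple of `F(1/t)`, `F` being the partial Fourier integral, because `Re σ̂ ≥
1/2` on the unit ball. The middle range costs at most `F(M/t) - F(1/t)`. The high range is
negligible for large `M`, since the decay of `σ̂` beats the growth `T^(d-s)` when `d - s ≤ 1/6`.
Hence a small middle increment forces `t` to be a distance
(`mem_distanceSet_of_middle_frequencies_small`).

A small increment must occur by pigeonhole (`IsLacunary.exists_small_increment`): along a lacunary
sequence sparse enough that the ranges `[1/t, M/t]` do not overlap, large increments would add up to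
more than `C T^(d-s)`.

Since `E` is only Borel, `μ` is first restricted to a compact subset of almost full measure. The
high frequency bound survives because Gaussian averages of `|μ̂|²` are monotone in `μ`
(`integral_closedBall_norm_charFun_sq_le_of_le`). -/

/-! ### Oscillatory integrals over the circle -/

/-- The phase `r cos θ` has derivative `-r sin θ`, bounded away from zero on this range, so one
integration by parts against `i / (r sin θ)` suffices. -/
lemma norm_integral_cexp_mul_cos_le_of_sin {r δ : ℝ} (hr : 0 < r) (hδ : 0 < δ)
    (hδ' : δ ≤ Real.pi / 2) :
    ‖∫ θ in δ..(Real.pi - δ), Complex.exp ((r * Real.cos θ : ℝ) * Complex.I)‖ ≤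
      2 / (r * Real.sin δ) + Real.pi / (r * Real.sin δ ^ 2) := by
  have hle : δ ≤ Real.pi - δ := by linarith
  have hsδ : 0 < Real.sin δ := Real.sin_pos_of_pos_of_lt_pi hδ (by linarith [Real.pi_pos])
  have hsin : ∀ θ ∈ Set.Icc δ (Real.pi - δ), Real.sin δ ≤ Real.sin θ := by
    intro θ hθ
    rcases le_total θ (Real.pi / 2) with h | h
    · exact Real.sin_le_sin_of_le_of_le_pi_div_two (by linarith) h hθ.1
    · rw [← Real.sin_pi_sub θ]
      exact Real.sin_le_sin_of_le_of_le_pi_div_two (by linarith) (by linarith) (by linarith [hθ.2])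
  set u : ℝ → ℂ := fun θ => Complex.I * ((r * Real.sin θ)⁻¹ : ℝ) with hu
  set u' : ℝ → ℂ := fun θ => Complex.I * ((-(r * Real.cos θ) / (r * Real.sin θ) ^ 2 : ℝ) : ℂ)
    with hu'
  set v : ℝ → ℂ := fun θ => Complex.exp ((r * Real.cos θ : ℝ) * Complex.I) with hv
  set v' : ℝ → ℂ := fun θ =>
    Complex.exp ((r * Real.cos θ : ℝ) * Complex.I) * ((-(r * Real.sin θ) : ℝ) * Complex.I) with hv'
  have hnv : ∀ θ, ‖v θ‖ = 1 := fun θ => Complex.norm_exp_ofReal_mul_I _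
  have hpos : ∀ θ ∈ Set.uIcc δ (Real.pi - δ), 0 < r * Real.sin θ := by
    intro θ hθ
    rw [Set.uIcc_of_le hle] at hθ
    exact mul_pos hr (hsδ.trans_le (hsin θ hθ))
  have hdu : ∀ θ ∈ Set.uIcc δ (Real.pi - δ), HasDerivAt u (u' θ) θ := by
    intro θ hθ
    have h1 : HasDerivAt (fun θ => (r * Real.sin θ)⁻¹) (-(r * Real.cos θ) / (r * Real.sin θ) ^ 2) θ :=
      ((Real.hasDerivAt_sin θ).const_mul r).inv (hpos θ hθ).ne'
    exact h1.ofReal_comp.const_mul Complex.I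
  have hdv : ∀ θ ∈ Set.uIcc δ (Real.pi - δ), HasDerivAt v (v' θ) θ := by
    intro θ _
    have h1 : HasDerivAt (fun θ => r * Real.cos θ) (-(r * Real.sin θ)) θ := by
      simpa using (Real.hasDerivAt_cos θ).const_mul r
    exact (h1.ofReal_comp.mul_const Complex.I).cexp
  have hcu' : ContinuousOn u' (Set.uIcc δ (Real.pi - δ)) := by
    refine continuousOn_const.mul (Complex.continuous_ofReal.comp_continuousOn ?_)
    refine ContinuousOn.div (by fun_prop) (by fun_prop) fun θ hθ => ?_
    exact pow_ne_zero _ (hpos θ hθ).ne'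
  have hcv' : Continuous v' := by fun_prop
  have hibp := intervalIntegral.integral_mul_deriv_eq_deriv_mul hdu hdv
    hcu'.intervalIntegrable (hcv'.intervalIntegrable _ _)
  have hcongr : ∫ θ in δ..(Real.pi - δ), v θ = ∫ θ in δ..(Real.pi - δ), u θ * v' θ := by
    refine intervalIntegral.integral_congr fun θ hθ => ?_
    have h0 : ((r * Real.sin θ : ℝ) : ℂ) ≠ 0 := by exact_mod_cast (hpos θ hθ).ne'
    have h1 : u θ * v' θ = v θ * (-(Complex.I * Complex.I)) *
        (((r * Real.sin θ : ℝ) : ℂ)⁻¹ * ((r * Real.sin θ : ℝ) : ℂ)) := by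
      simp only [hu, hv', hv]; push_cast; ring
    rw [h1, inv_mul_cancel₀ h0]
    simp
  have hnu : ∀ θ ∈ Set.Icc δ (Real.pi - δ), ‖u θ‖ ≤ 1 / (r * Real.sin δ) := by
    intro θ hθ
    have := hsin θ hθ
    have h2 : 0 < Real.sin θ := hsδ.trans_le this
    simp only [hu, norm_mul, Complex.norm_I, one_mul, Complex.norm_real, norm_inv, Real.norm_eq_abs,
      abs_of_pos hr, abs_of_pos h2, one_div]
    gcongr
  have hnu' : ∀ θ ∈ Set.uIoc δ (Real.pi - δ), ‖u' θ * v θ‖ ≤ 1 / (r * Real.sin δ ^ 2) := by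
    intro θ hθ
    rw [Set.uIoc_of_le hle] at hθ
    have := hsin θ ⟨hθ.1.le, hθ.2⟩
    have h2 : 0 < Real.sin θ := hsδ.trans_le this
    rw [norm_mul, hnv, mul_one]
    simp only [hu', norm_mul, Complex.norm_I, one_mul, Complex.norm_real, norm_div, norm_neg,
      norm_pow, Real.norm_eq_abs, abs_of_pos hr, abs_of_pos h2]
    calc r * |Real.cos θ| / (r * Real.sin θ) ^ 2 ≤ r * 1 / (r * Real.sin δ) ^ 2 := by
          gcongr
          exact Real.abs_cos_le_one θ
      _ = 1 / (r * Real.sin δ ^ 2) := by field_simp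
  have hint := intervalIntegral.norm_integral_le_of_norm_le_const hnu'
  have hlen : 1 / (r * Real.sin δ ^ 2) * |Real.pi - δ - δ| ≤ Real.pi / (r * Real.sin δ ^ 2) := by
    rw [abs_of_nonneg (by linarith), one_div_mul_eq_div]
    gcongr
    linarith
  change ‖∫ θ in δ..(Real.pi - δ), v θ‖ ≤ _
  rw [hcongr, hibp]
  calc _ ≤ ‖u (Real.pi - δ) * v (Real.pi - δ)‖ + ‖u δ * v δ‖ + ‖∫ θ in δ..(Real.pi - δ), u' θ * v θ‖ :=
        (norm_sub_le _ _).trans (by gcongr; exact norm_sub_le _ _)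
    _ ≤ 1 / (r * Real.sin δ) + 1 / (r * Real.sin δ) + Real.pi / (r * Real.sin δ ^ 2) := by
        rw [norm_mul (u _), norm_mul (u _), hnv, hnv, mul_one, mul_one]
        exact add_le_add (add_le_add (hnu _ ⟨hle, le_rfl⟩) (hnu _ ⟨le_rfl, hle⟩)) (hint.trans hlen)
    _ = _ := by ring

lemma norm_intervalIntegral_cexp_le (f : ℝ → ℝ) {a b : ℝ} (hab : a ≤ b) :
    ‖∫ θ in a..b, Complex.exp ((f θ : ℝ) * Complex.I)‖ ≤ b - a := by
  have := intervalIntegral.norm_integral_le_of_norm_le_const (a := a) (b := b) (C := 1)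
    (f := fun θ => Complex.exp ((f θ : ℝ) * Complex.I))
    (fun θ _ => (Complex.norm_exp_ofReal_mul_I _).le)
  rwa [one_mul, abs_of_nonneg (by linarith)] at this

lemma norm_integral_cexp_mul_cos_le {r : ℝ} (hr : 0 < r) :
    ‖∫ θ in (0 : ℝ)..Real.pi, Complex.exp ((r * Real.cos θ : ℝ) * Complex.I)‖ ≤
      20 * r ^ (-(1 / 3) : ℝ) := by
  rcases le_total r 1 with h1 | h1
  · have h2 : 1 ≤ r ^ (-(1 / 3) : ℝ) := Real.one_le_rpow_of_pos_of_le_one_of_nonpos hr h1 (by norm_num)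
    have := norm_intervalIntegral_cexp_le (fun θ => r * Real.cos θ) Real.pi_pos.le
    linarith [Real.pi_lt_four]
  -- This cut-off balances the trivial bound `δ` near the critical points `0` and `π` against the
  -- main term `1 / (r δ²)` in between.
  set δ := r ^ (-(1 / 3) : ℝ) with hδdef
  have hδ : 0 < δ := Real.rpow_pos_of_pos hr _
  have hδ1 : δ ≤ 1 := Real.rpow_le_one_of_one_le_of_nonpos h1 (by norm_num)
  have hδ3 : r * δ ^ 3 = 1 := by
    rw [hδdef, ← Real.rpow_natCast, ← Real.rpow_mul hr.le]
    norm_num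
    rw [Real.rpow_neg_one, mul_inv_cancel₀ hr.ne']
  have hpi := Real.pi_gt_three
  have hpi4 := Real.pi_lt_four
  have hs : δ / 2 ≤ Real.sin δ := by
    refine le_trans ?_ (Real.mul_le_sin hδ.le (by linarith))
    rw [div_eq_inv_mul]
    gcongr
    rw [inv_eq_one_div, div_le_div_iff₀ (by norm_num) Real.pi_pos]
    linarith
  have hmid := norm_integral_cexp_mul_cos_le_of_sin hr hδ (by linarith)
  have hcont : Continuous fun θ : ℝ => Complex.exp ((r * Real.cos θ : ℝ) * Complex.I) := by fun_prop
  have hint : ∀ a b, IntervalIntegrable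
      (fun θ : ℝ => Complex.exp ((r * Real.cos θ : ℝ) * Complex.I)) volume a b :=
    fun a b => hcont.intervalIntegrable a b
  rw [← intervalIntegral.integral_add_adjacent_intervals (hint 0 (Real.pi - δ)) (hint _ _),
    ← intervalIntegral.integral_add_adjacent_intervals (hint 0 δ) (hint _ _)]
  have e1 := norm_intervalIntegral_cexp_le (fun θ => r * Real.cos θ) hδ.le
  have e2 := norm_intervalIntegral_cexp_le (fun θ => r * Real.cos θ)
    (show Real.pi - δ ≤ Real.pi by linarith)
  have hrd : r * δ ^ 2 = 1 / δ := by field_simp; linarith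
  have b1 : 2 / (r * Real.sin δ) ≤ 4 * δ := by
    calc 2 / (r * Real.sin δ) ≤ 2 / (r * (δ / 2)) := by gcongr
      _ = 4 * δ * (1 / (r * δ ^ 2)) := by field_simp; ring
      _ = 4 * δ * δ := by rw [hrd, one_div_one_div]
      _ ≤ 4 * δ := by nlinarith
  have b2 : Real.pi / (r * Real.sin δ ^ 2) ≤ 13 * δ := by
    calc Real.pi / (r * Real.sin δ ^ 2) ≤ 3.25 / (r * (δ / 2) ^ 2) := by
          gcongr
          linarith [Real.pi_lt_d2]
      _ = 13 * (1 / (r * δ ^ 2)) := by field_simp; ring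
      _ = 13 * δ := by rw [hrd, one_div_one_div]
  refine (norm_add_le _ _).trans ((add_le_add_left (norm_add_le _ _) _).trans ?_)
  linarith

/-- In polar form the phase is `r cos (θ - α)`, with `r² = a² + b²`; periodicity removes `α`, and
evenness gives twice the integral over `[0, π]`. -/
lemma norm_integral_cexp_circle_le {a b R : ℝ} (hR : 0 < R) (h : R ^ 2 ≤ a ^ 2 + b ^ 2) :
    ‖∫ θ in (0 : ℝ)..(2 * Real.pi),
        Complex.exp ((a * Real.cos θ + b * Real.sin θ : ℝ) * Complex.I)‖ ≤
      40 * R ^ (-(1 / 3) : ℝ) := by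
  set z : ℂ := ⟨a, b⟩
  set r : ℝ := ‖z‖ with hr
  set α : ℝ := z.arg
  have ha : r * Real.cos α = a := Complex.norm_mul_cos_arg z
  have hb : r * Real.sin α = b := Complex.norm_mul_sin_arg z
  have hr2 : r ^ 2 = a ^ 2 + b ^ 2 := by
    rw [← ha, ← hb]; linear_combination (-r ^ 2) * Real.sin_sq_add_cos_sq α
  have hRr : R ≤ r := by
    refine le_of_sq_le_sq ?_ (norm_nonneg z)
    rw [hr2]; exact h
  have hrpos : 0 < r := hR.trans_le hRr
  set f : ℝ → ℂ := fun θ => Complex.exp ((r * Real.cos θ : ℝ) * Complex.I) with hf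
  have hfc : Continuous f := by fun_prop
  have hper : Function.Periodic f (2 * Real.pi) := fun θ => by
    simp only [hf, Real.cos_add_two_pi]
  have h1 : ∫ θ in (0 : ℝ)..(2 * Real.pi),
        Complex.exp ((a * Real.cos θ + b * Real.sin θ : ℝ) * Complex.I) =
      ∫ θ in (0 : ℝ)..(2 * Real.pi), f (θ - α) := by
    refine intervalIntegral.integral_congr fun θ _ => ?_
    simp only [hf, Real.cos_sub]
    rw [← ha, ← hb]
    congr 3
    ring
  have h2 : ∫ θ in (0 : ℝ)..(2 * Real.pi), f (θ - α) = ∫ θ in (-Real.pi)..Real.pi, f θ := by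
    rw [intervalIntegral.integral_comp_sub_right]
    have := hper.intervalIntegral_add_eq (0 - α) (-Real.pi)
    convert this using 2 <;> ring
  have h3 : ∫ θ in (-Real.pi)..Real.pi, f θ = 2 * ∫ θ in (0 : ℝ)..Real.pi, f θ := by
    rw [← intervalIntegral.integral_add_adjacent_intervals (hfc.intervalIntegrable (-Real.pi) 0)
      (hfc.intervalIntegrable _ _)]
    have : ∫ θ in (-Real.pi)..0, f θ = ∫ θ in (0 : ℝ)..Real.pi, f (-θ) := by
      rw [intervalIntegral.integral_comp_neg, neg_zero]
    rw [this, two_mul]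
    congr 1
    simp [hf]
  rw [h1, h2, h3, norm_mul]
  have h4 := norm_integral_cexp_mul_cos_le hrpos
  have h5 : r ^ (-(1 / 3) : ℝ) ≤ R ^ (-(1 / 3) : ℝ) :=
    Real.rpow_le_rpow_of_nonpos hR hRr (by norm_num)
  simp only [Complex.norm_ofNat]
  linarith

/-! ### A measure on the unit sphere with Fourier decay -/

/-- The uniform probability measure on `(0, 2π]`. -/
noncomputable def angleMeasure : Measure ℝ :=
  (ENNReal.ofReal (2 * Real.pi))⁻¹ • volume.restrict (Set.Ioc 0 (2 * Real.pi))

instance : IsProbabilityMeasure angleMeasure := by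
  constructor
  have h : ENNReal.ofReal (2 * Real.pi) ≠ 0 := by
    simpa using Real.pi_pos
  simp only [angleMeasure, Measure.smul_apply, Measure.restrict_apply_univ, Real.volume_Ioc,
    sub_zero, smul_eq_mul]
  exact ENNReal.inv_mul_cancel h ENNReal.ofReal_ne_top

lemma integral_angleMeasure {V : Type*} [NormedAddCommGroup V] [NormedSpace ℝ V] (f : ℝ → V) :
    ∫ θ, f θ ∂angleMeasure = (2 * Real.pi)⁻¹ • ∫ θ in (0 : ℝ)..(2 * Real.pi), f θ := by
  have h : (0 : ℝ) ≤ 2 * Real.pi := by positivity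
  rw [angleMeasure, integral_smul_measure, intervalIntegral.integral_of_le h, ENNReal.toReal_inv,
    ENNReal.toReal_ofReal h]

/-- The point of the unit sphere of `ℝ^(d+1)` at height `sin θ` above `x` in the unit sphere
of `ℝ^d`. -/
noncomputable def suspend {d : ℕ} (p : ℝ × EuclideanSpace ℝ (Fin d)) :
    EuclideanSpace ℝ (Fin (d + 1)) :=
  WithLp.toLp 2 (Fin.cons (Real.sin p.1) fun i => Real.cos p.1 * p.2 i)

/-- The vector of all coordinates but the first. -/
noncomputable def euclideanTail {d : ℕ} (ξ : EuclideanSpace ℝ (Fin (d + 1))) :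
    EuclideanSpace ℝ (Fin d) :=
  WithLp.toLp 2 fun i => ξ i.succ

lemma norm_sq_eq_sq_add_norm_euclideanTail_sq {d : ℕ} (ξ : EuclideanSpace ℝ (Fin (d + 1))) :
    ‖ξ‖ ^ 2 = ξ 0 ^ 2 + ‖euclideanTail ξ‖ ^ 2 := by
  simp [EuclideanSpace.norm_sq_eq, Fin.sum_univ_succ, euclideanTail]

lemma inner_suspend {d : ℕ} (p : ℝ × EuclideanSpace ℝ (Fin d))
    (ξ : EuclideanSpace ℝ (Fin (d + 1))) :
    inner ℝ (suspend p) ξ =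
      inner ℝ p.2 (euclideanTail ξ) * Real.cos p.1 + ξ 0 * Real.sin p.1 := by
  simp only [PiLp.inner_apply, suspend, Fin.sum_univ_succ, euclideanTail, Fin.cons_zero,
    Fin.cons_succ, RCLike.inner_apply, conj_trivial, Finset.sum_mul]
  rw [add_comm]
  congr 1
  exact Finset.sum_congr rfl fun i _ => by ring

lemma norm_suspend {d : ℕ} (θ : ℝ) {x : EuclideanSpace ℝ (Fin d)} (hx : ‖x‖ = 1) :
    ‖suspend (θ, x)‖ = 1 := by
  have h1 : ‖x‖ ^ 2 = 1 := by rw [hx]; norm_num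
  have : ‖suspend (θ, x)‖ ^ 2 = 1 := by
    rw [EuclideanSpace.norm_sq_eq] at h1 ⊢
    simp only [Real.norm_eq_abs, sq_abs] at h1
    simp only [suspend, Fin.sum_univ_succ, Fin.cons_zero, Fin.cons_succ, mul_pow,
      ← Finset.mul_sum, h1, Real.norm_eq_abs, sq_abs, mul_one, Real.sin_sq_add_cos_sq]
  nlinarith [norm_nonneg (suspend (θ, x))]

lemma continuous_suspend {d : ℕ} :
    Continuous (suspend : ℝ × EuclideanSpace ℝ (Fin d) → EuclideanSpace ℝ (Fin (d + 1))) := by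
  refine (PiLp.continuous_toLp 2 _).comp (continuous_pi fun i => ?_)
  refine Fin.cases ?_ (fun i => ?_) i
  · simp only [Fin.cons_zero]; fun_prop
  · simp only [Fin.cons_succ]; fun_prop

/-- The suspension of a measure on `ℝ^d`. -/
noncomputable def suspendMeasure {d : ℕ} (σ : Measure (EuclideanSpace ℝ (Fin d))) :
    Measure (EuclideanSpace ℝ (Fin (d + 1))) :=
  (angleMeasure.prod σ).map suspend

instance {d : ℕ} (σ : Measure (EuclideanSpace ℝ (Fin d))) [IsProbabilityMeasure σ] :
    IsProbabilityMeasure (suspendMeasure σ) :=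
  Measure.isProbabilityMeasure_map continuous_suspend.measurable.aemeasurable

lemma ae_norm_suspendMeasure {d : ℕ} (σ : Measure (EuclideanSpace ℝ (Fin d)))
    [IsProbabilityMeasure σ] (hσ : ∀ᵐ x ∂σ, ‖x‖ = 1) : ∀ᵐ x ∂suspendMeasure σ, ‖x‖ = 1 := by
  rw [suspendMeasure, ae_map_iff continuous_suspend.measurable.aemeasurable
    (measurableSet_eq_fun (by fun_prop) (by fun_prop))]
  have h : ∀ᵐ p ∂(angleMeasure.prod σ), ‖p.2‖ = 1 :=
    Measure.quasiMeasurePreserving_snd.ae hσ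
  filter_upwards [h] with p hp
  exact norm_suspend p.1 hp

lemma integrable_cexp_mul_I {α : Type*} [MeasurableSpace α] {μ : Measure α} [IsFiniteMeasure μ]
    {f : α → ℝ} (hf : Measurable f) :
    Integrable (fun x => Complex.exp ((f x : ℝ) * Complex.I)) μ :=
  Integrable.of_bound (by fun_prop) 1
    (Eventually.of_forall fun _ => (Complex.norm_exp_ofReal_mul_I _).le)

lemma charFun_suspendMeasure {d : ℕ} (σ : Measure (EuclideanSpace ℝ (Fin d)))
    [IsProbabilityMeasure σ] (ξ : EuclideanSpace ℝ (Fin (d + 1))) :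
    charFun (suspendMeasure σ) ξ = ∫ p, Complex.exp
      ((inner ℝ p.2 (euclideanTail ξ) * Real.cos p.1 + ξ 0 * Real.sin p.1 : ℝ) * Complex.I)
        ∂(angleMeasure.prod σ) := by
  rw [charFun_apply, suspendMeasure, integral_map continuous_suspend.measurable.aemeasurable
    (by fun_prop)]
  simp only [inner_suspend]

/-- Fubini with the angle innermost: for each `x` the inner integral is an oscillatory circle
integral of amplitude at least `R`. -/
lemma norm_charFun_suspendMeasure_le {d : ℕ} (σ : Measure (EuclideanSpace ℝ (Fin d)))
    [IsProbabilityMeasure σ] (ξ : EuclideanSpace ℝ (Fin (d + 1))) {R : ℝ} (hR : 0 < R)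
    (h : ∀ᵐ x ∂σ, R ^ 2 ≤ inner ℝ x (euclideanTail ξ) ^ 2 + ξ 0 ^ 2) :
    ‖charFun (suspendMeasure σ) ξ‖ ≤ 40 * R ^ (-(1 / 3) : ℝ) := by
  rw [charFun_suspendMeasure, integral_prod_symm _ (integrable_cexp_mul_I (by fun_prop))]
  refine (norm_integral_le_of_norm_le_const (C := 40 * R ^ (-(1 / 3) : ℝ)) ?_).trans (by simp)
  filter_upwards [h] with x hx
  rw [integral_angleMeasure, norm_smul]
  have h1 := norm_integral_cexp_circle_le hR hx
  have h2 : ‖(2 * Real.pi)⁻¹‖ ≤ 1 := by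
    rw [norm_inv, Real.norm_of_nonneg (by positivity)]
    exact inv_le_one_of_one_le₀ (by linarith [Real.pi_gt_three])
  calc _ ≤ 1 * _ := mul_le_mul_of_nonneg_right h2 (norm_nonneg _)
    _ ≤ _ := by rw [one_mul]; exact h1

/-- Fubini in the other order: for fixed `θ` the height contributes only a unimodular factor,
leaving `σ̂` at a rescaled tail. -/
lemma norm_charFun_suspendMeasure_le_integral {d : ℕ} (σ : Measure (EuclideanSpace ℝ (Fin d)))
    [IsProbabilityMeasure σ] (ξ : EuclideanSpace ℝ (Fin (d + 1))) :
    ‖charFun (suspendMeasure σ) ξ‖ ≤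
      ∫ θ, ‖charFun σ (Real.cos θ • euclideanTail ξ)‖ ∂angleMeasure := by
  rw [charFun_suspendMeasure, integral_prod _ (integrable_cexp_mul_I (by fun_prop))]
  refine (norm_integral_le_integral_norm _).trans (le_of_eq (integral_congr_ae ?_))
  refine Eventually.of_forall fun θ => ?_
  have : ∀ x : EuclideanSpace ℝ (Fin d), Complex.exp
      ((inner ℝ x (euclideanTail ξ) * Real.cos θ + ξ 0 * Real.sin θ : ℝ) * Complex.I) =
      Complex.exp ((inner ℝ x (Real.cos θ • euclideanTail ξ) : ℝ) * Complex.I) *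
        Complex.exp ((ξ 0 * Real.sin θ : ℝ) * Complex.I) := by
    intro x
    rw [← Complex.exp_add, inner_smul_right]
    push_cast
    ring_nf
  simp only [this]
  rw [integral_mul_const, norm_mul, Complex.norm_exp_ofReal_mul_I, mul_one, charFun_apply]

/-- For negative `x`, `x ^ y` is `|x| ^ y * cos (π y)`, and `cos (π / 3) = 1 / 2`. This transfers
integrability of real powers across the origin to `|x| ^ (-1/3)`. -/
lemma abs_rpow_neg_third_le (x : ℝ) : |x| ^ (-(1 / 3) : ℝ) ≤ 2 * ‖x ^ (-(1 / 3) : ℝ)‖ := by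
  rcases lt_or_ge x 0 with h | h
  · have : Real.cos (-(1 / 3) * Real.pi) = 1 / 2 := by
      rw [← Real.cos_pi_div_three, ← Real.cos_neg]; ring_nf
    rw [Real.rpow_def_of_neg h, this, norm_mul, Real.rpow_def_of_pos (abs_pos.mpr h.ne),
      Real.log_abs, Real.norm_eq_abs, Real.abs_exp]
    norm_num
    linarith
  · rw [abs_of_nonneg h, Real.norm_of_nonneg (Real.rpow_nonneg h _)]
    linarith [Real.rpow_nonneg h (-(1 / 3) : ℝ)]

lemma abs_sin_ge {x : ℝ} (hx : |x| ≤ Real.pi / 2) : 2 / Real.pi * |x| ≤ |Real.sin x| := by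
  refine (Real.mul_le_sin (abs_nonneg x) hx).trans ?_
  rcases abs_choice x with h | h <;> rw [h]
  · exact le_abs_self _
  · rw [Real.sin_neg]; exact neg_le_abs _

/-- An integrable majorant of `|cos θ|^(-1/3)`. -/
lemma exists_integrable_abs_cos_rpow_le :
    ∃ G : ℝ → ℝ, Integrable G angleMeasure ∧
      ∀ᵐ θ ∂angleMeasure, Real.cos θ ≠ 0 ∧ |Real.cos θ| ^ (-(1 / 3) : ℝ) ≤ G θ := by
  have hint : ∀ c : ℝ, Integrable (fun θ : ℝ => ‖(θ - c) ^ (-(1 / 3) : ℝ)‖) angleMeasure := by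
    intro c
    refine Integrable.smul_measure ?_ (by simpa using Real.pi_pos)
    refine Integrable.norm ?_
    have h := (intervalIntegral.intervalIntegrable_rpow' (a := 0 - c) (b := 2 * Real.pi - c)
      (r := -(1 / 3)) (by norm_num)).comp_sub_right c
    simp only [sub_add_cancel] at h
    exact (intervalIntegrable_iff_integrableOn_Ioc_of_le (by positivity)).mp h
  -- One term for each zero of the cosine in `(0, 2π]`; the estimate is split at `θ = π`.
  refine ⟨fun θ => (2 / Real.pi) ^ (-(1 / 3) : ℝ) * (2 * ‖(θ - Real.pi / 2) ^ (-(1 / 3) : ℝ)‖) +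
    (2 / Real.pi) ^ (-(1 / 3) : ℝ) * (2 * ‖(θ - 3 * Real.pi / 2) ^ (-(1 / 3) : ℝ)‖),
    (((hint _).const_mul 2).const_mul _).add (((hint _).const_mul 2).const_mul _), ?_⟩
  have hpi := Real.pi_pos
  have key : ∀ c θ : ℝ, |Real.cos θ| = |Real.sin (θ - c)| → |θ - c| ≤ Real.pi / 2 → θ ≠ c →
      Real.cos θ ≠ 0 ∧ |Real.cos θ| ^ (-(1 / 3) : ℝ) ≤
        (2 / Real.pi) ^ (-(1 / 3) : ℝ) * (2 * ‖(θ - c) ^ (-(1 / 3) : ℝ)‖) := by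
    intro c θ h1 h2 h3
    have h4 := abs_sin_ge h2
    have h5 : 0 < |θ - c| := abs_pos.mpr (sub_ne_zero.mpr h3)
    have h6 : 0 < 2 / Real.pi * |θ - c| := by positivity
    rw [← h1] at h4
    refine ⟨abs_pos.mp (h6.trans_le h4), ?_⟩
    calc _ ≤ (2 / Real.pi * |θ - c|) ^ (-(1 / 3) : ℝ) :=
          Real.rpow_le_rpow_of_nonpos h6 h4 (by norm_num)
      _ = (2 / Real.pi) ^ (-(1 / 3) : ℝ) * |θ - c| ^ (-(1 / 3) : ℝ) :=
          Real.mul_rpow (by positivity) (abs_nonneg _)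
      _ ≤ _ := by gcongr; exact abs_rpow_neg_third_le _
  have hae : ∀ c : ℝ, ∀ᵐ θ ∂angleMeasure, θ ≠ c := fun c =>
    (Measure.ae_smul_measure (ae_restrict_of_ae (Measure.ae_ne volume c)) _)
  have hmem : ∀ᵐ θ ∂angleMeasure, θ ∈ Set.Ioc 0 (2 * Real.pi) :=
    Measure.ae_smul_measure (ae_restrict_mem measurableSet_Ioc) _
  filter_upwards [hae (Real.pi / 2), hae (3 * Real.pi / 2), hmem] with θ h1 h2 h3
  rcases le_total θ Real.pi with h | h
  · have := key (Real.pi / 2) θ (by rw [Real.sin_sub_pi_div_two, abs_neg])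
      (abs_le.mpr ⟨by linarith [h3.1], by linarith⟩) h1
    exact ⟨this.1, this.2.trans (le_add_of_nonneg_right (by positivity))⟩
  · have := key (3 * Real.pi / 2) θ (by
        rw [show θ - 3 * Real.pi / 2 = θ - Real.pi - Real.pi / 2 by ring,
          Real.sin_sub_pi_div_two, Real.cos_sub_pi, neg_neg])
      (abs_le.mpr ⟨by linarith, by linarith [h3.2]⟩) h2
    exact ⟨this.1, this.2.trans (le_add_of_nonneg_left (by positivity))⟩

/-- For `d ≥ 2` the unit sphere of `ℝ^d` carries a probability measure whose Fourier transform
decays polynomially. -/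
theorem exists_sphere_measure_charFun_decay {d : ℕ} (hd : 2 ≤ d) :
    ∃ σ : Measure (EuclideanSpace ℝ (Fin d)), IsProbabilityMeasure σ ∧ (∀ᵐ x ∂σ, ‖x‖ = 1) ∧
      ∃ B : ℝ, 0 ≤ B ∧ ∀ ξ, ξ ≠ 0 → ‖charFun σ ξ‖ ≤ B * ‖ξ‖ ^ (-(1 / 3) : ℝ) := by
  induction d, hd using Nat.le_induction with
  | base =>
    -- The circle is the suspension of a single point: a Dirac mass at `1` already yields all of it.
    set e : EuclideanSpace ℝ (Fin 1) := WithLp.toLp 2 fun _ => 1 with he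
    refine ⟨suspendMeasure (Measure.dirac e), inferInstance, ae_norm_suspendMeasure _ ?_, 40,
      by norm_num, fun ξ hξ => norm_charFun_suspendMeasure_le _ ξ (norm_pos_iff.mpr hξ) ?_⟩
    · rw [ae_dirac_eq]
      change ‖e‖ = 1
      simp [he, EuclideanSpace.norm_eq]
    · rw [ae_dirac_eq]
      change ‖ξ‖ ^ 2 ≤ inner ℝ e (euclideanTail ξ) ^ 2 + ξ 0 ^ 2
      rw [norm_sq_eq_sq_add_norm_euclideanTail_sq, add_comm]
      simp [he, EuclideanSpace.norm_sq_eq, PiLp.inner_apply]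
  | succ d hd ih =>
    obtain ⟨σ, hσ, hσ1, B, hB, hdec⟩ := ih
    obtain ⟨G, hG, hGle⟩ := exists_integrable_abs_cos_rpow_le
    refine ⟨suspendMeasure σ, inferInstance, ae_norm_suspendMeasure _ hσ1,
      (40 + B * |∫ θ, G θ ∂angleMeasure|) * (1 / 2) ^ (-(1 / 3) : ℝ), by positivity,
      fun ξ hξ => ?_⟩
    have hξ0 : 0 < ‖ξ‖ := norm_pos_iff.mpr hξ
    have hhalf : (0 : ℝ) < 1 / 2 * ‖ξ‖ := by positivity
    rw [mul_assoc, ← Real.mul_rpow (by norm_num) hξ0.le]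
    have hpyth := norm_sq_eq_sq_add_norm_euclideanTail_sq ξ
    have hrp : 0 ≤ (1 / 2 * ‖ξ‖) ^ (-(1 / 3) : ℝ) := Real.rpow_nonneg hhalf.le _
    -- If the first coordinate is a fixed proportion of `ξ`, the angle oscillates; otherwise the
    -- tail is large and the inductive decay applies, losing only the integrable factor `|cos θ| ^
    -- (-1/3)`.
    by_cases hc : (1 / 2 * ‖ξ‖) ^ 2 ≤ ξ 0 ^ 2
    · refine (norm_charFun_suspendMeasure_le σ ξ hhalf (Eventually.of_forall fun x => ?_)).trans ?_
      · linarith [sq_nonneg (inner ℝ x (euclideanTail ξ))]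
      · gcongr
        exact le_add_of_nonneg_right (by positivity)
    · have htail : 1 / 2 * ‖ξ‖ ≤ ‖euclideanTail ξ‖ := by
        refine le_of_sq_le_sq ?_ (norm_nonneg _)
        nlinarith
      have htpos : 0 < ‖euclideanTail ξ‖ := hhalf.trans_le htail
      refine (norm_charFun_suspendMeasure_le_integral σ ξ).trans ?_
      calc _ ≤ ∫ θ, B * (1 / 2 * ‖ξ‖) ^ (-(1 / 3) : ℝ) * G θ ∂angleMeasure := by
            refine integral_mono_of_nonneg (Eventually.of_forall fun _ => norm_nonneg _)
              (hG.const_mul _) ?_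
            filter_upwards [hGle] with θ hθ
            have hne : euclideanTail ξ ≠ 0 := norm_pos_iff.mp htpos
            refine (hdec _ (smul_ne_zero hθ.1 hne)).trans ?_
            rw [norm_smul, Real.mul_rpow (norm_nonneg _) (norm_nonneg _), mul_assoc,
              mul_comm (‖Real.cos θ‖ ^ _)]
            refine mul_le_mul_of_nonneg_left ?_ hB
            exact mul_le_mul (Real.rpow_le_rpow_of_nonpos hhalf htail (by norm_num)) hθ.2
              (by positivity) hrp
        _ = B * (∫ θ, G θ ∂angleMeasure) * (1 / 2 * ‖ξ‖) ^ (-(1 / 3) : ℝ) := by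
            rw [integral_const_mul]; ring
        _ ≤ _ := by
            gcongr
            have := mul_le_mul_of_nonneg_left (le_abs_self (∫ θ, G θ ∂angleMeasure)) hB
            linarith

/-! ### Gaussian averages of characteristic functions -/

lemma integrable_exp_neg_mul_norm_sq {d : ℕ} {b : ℝ} (hb : 0 < b) :
    Integrable fun ξ : EuclideanSpace ℝ (Fin d) => Real.exp (-b * ‖ξ‖ ^ 2) := by
  have h := (GaussianFourier.integrable_cexp_neg_mul_sq_norm_add (b := (b : ℂ)) (by simpa using hb)
    0 (0 : EuclideanSpace ℝ (Fin d))).re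
  refine h.congr (Eventually.of_forall fun ξ => ?_)
  simp only [zero_mul, add_zero]
  change (Complex.exp _).re = _
  norm_cast

lemma integral_cexp_inner_mul_gaussian {d : ℕ} {b : ℝ} (hb : 0 < b)
    (z : EuclideanSpace ℝ (Fin d)) :
    ∫ ξ : EuclideanSpace ℝ (Fin d),
        Complex.exp ((inner ℝ z ξ : ℝ) * Complex.I) * (Real.exp (-b * ‖ξ‖ ^ 2) : ℝ) =
      (((Real.pi / b) ^ (d / 2 : ℝ) * Real.exp (-‖z‖ ^ 2 / (4 * b)) : ℝ) : ℂ) := by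
  have h := GaussianFourier.integral_cexp_neg_mul_sq_norm_add (b := (b : ℂ)) (by simpa using hb)
    Complex.I z
  rw [finrank_euclideanSpace_fin] at h
  have h2 : (((Real.pi / b) ^ (d / 2 : ℝ) * Real.exp (-‖z‖ ^ 2 / (4 * b)) : ℝ) : ℂ) =
      ((Real.pi : ℂ) / b) ^ (d / 2 : ℂ) * Complex.exp (Complex.I ^ 2 * ‖z‖ ^ 2 / (4 * b)) := by
    rw [Complex.ofReal_mul, Complex.ofReal_cpow (by positivity), Complex.ofReal_exp]
    push_cast
    rw [Complex.I_sq, neg_one_mul]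
  rw [h2, ← h]
  refine integral_congr_ae (Eventually.of_forall fun ξ => ?_)
  simp only
  rw [Complex.ofReal_exp, ← Complex.exp_add]
  push_cast
  ring_nf

lemma integral_charFun_mul_gaussian {d : ℕ} (ν : Measure (EuclideanSpace ℝ (Fin d)))
    [IsFiniteMeasure ν] {b : ℝ} (hb : 0 < b) :
    ∫ ξ, charFun ν ξ * (Real.exp (-b * ‖ξ‖ ^ 2) : ℝ) =
      (((Real.pi / b) ^ (d / 2 : ℝ) * ∫ z, Real.exp (-‖z‖ ^ 2 / (4 * b)) ∂ν : ℝ) : ℂ) := by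
  simp only [charFun_apply, ← integral_mul_const]
  rw [integral_integral_swap]
  · simp only [integral_cexp_inner_mul_gaussian hb]
    rw [integral_complex_ofReal, integral_const_mul]
  · have h1 : Integrable (fun p : EuclideanSpace ℝ (Fin d) × EuclideanSpace ℝ (Fin d) =>
        Real.exp (-b * ‖p.1‖ ^ 2) * (1 : ℝ)) (volume.prod ν) :=
      (integrable_exp_neg_mul_norm_sq hb).mul_prod (integrable_const 1)
    refine h1.mono (by unfold Function.uncurry; fun_prop) (Eventually.of_forall fun p => ?_)
    simp only [Function.uncurry, norm_mul, Complex.norm_exp_ofReal_mul_I, Complex.norm_real,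
      one_mul, mul_one, le_refl]

/-- The law of `x - y + t ω` for independent `x, y` of law `μ` and `ω` of law `σ`. -/
noncomputable def shiftedDifferenceLaw {d : ℕ} (μ σ : Measure (EuclideanSpace ℝ (Fin d))) (t : ℝ) :
    Measure (EuclideanSpace ℝ (Fin d)) :=
  (μ.prod (μ.prod σ)).map fun p => p.1 - p.2.1 + t • p.2.2

/-- Independence factors the characteristic function; the variables `x` and `-y` contribute
conjugate factors. -/
lemma charFun_shiftedDifferenceLaw {d : ℕ} (μ σ : Measure (EuclideanSpace ℝ (Fin d)))
    [IsFiniteMeasure μ] [IsFiniteMeasure σ] (t : ℝ) (ξ : EuclideanSpace ℝ (Fin d)) :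
    charFun (shiftedDifferenceLaw μ σ t) ξ =
      ((‖charFun μ ξ‖ ^ 2 : ℝ) : ℂ) * charFun σ (t • ξ) := by
  rw [charFun_apply, shiftedDifferenceLaw, integral_map (by fun_prop) (by fun_prop)]
  have h : ∀ p : EuclideanSpace ℝ (Fin d) × EuclideanSpace ℝ (Fin d) × EuclideanSpace ℝ (Fin d),
      Complex.exp ((inner ℝ (p.1 - p.2.1 + t • p.2.2) ξ : ℝ) * Complex.I) =
      Complex.exp ((inner ℝ p.1 ξ : ℝ) * Complex.I) *
        (Complex.exp ((inner ℝ p.2.1 (-ξ) : ℝ) * Complex.I) *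
          Complex.exp ((inner ℝ p.2.2 (t • ξ) : ℝ) * Complex.I)) := by
    intro p
    rw [← Complex.exp_add, ← Complex.exp_add, inner_add_left, inner_sub_left, inner_neg_right,
      inner_smul_left, inner_smul_right]
    congr 1
    simp only [conj_trivial]
    push_cast
    ring
  simp only [h]
  rw [integral_prod_mul (μ := μ) (ν := μ.prod σ)
    (fun x => Complex.exp ((inner ℝ x ξ : ℝ) * Complex.I))
    (fun q => Complex.exp ((inner ℝ q.1 (-ξ) : ℝ) * Complex.I) *
          Complex.exp ((inner ℝ q.2 (t • ξ) : ℝ) * Complex.I)),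
    integral_prod_mul (μ := μ) (ν := σ)
    (fun x => Complex.exp ((inner ℝ x (-ξ) : ℝ) * Complex.I))
    (fun x => Complex.exp ((inner ℝ x (t • ξ) : ℝ) * Complex.I)),
    ← charFun_apply, ← charFun_apply, ← charFun_apply, charFun_neg, ← mul_assoc,
    Complex.mul_conj, Complex.normSq_eq_norm_sq]

instance {d : ℕ} (μ σ : Measure (EuclideanSpace ℝ (Fin d)))
    [IsFiniteMeasure μ] [IsFiniteMeasure σ] (t : ℝ) :
    IsFiniteMeasure (shiftedDifferenceLaw μ σ t) := by
  unfold shiftedDifferenceLaw; infer_instance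

lemma integrable_norm_charFun_sq_mul {d : ℕ} (μ : Measure (EuclideanSpace ℝ (Fin d)))
    [IsFiniteMeasure μ] {w : EuclideanSpace ℝ (Fin d) → ℝ} (hw : Integrable w) :
    Integrable fun ξ => ‖charFun μ ξ‖ ^ 2 * w ξ := by
  refine hw.bdd_mul (c := μ.real Set.univ ^ 2)
    (measurable_charFun.norm.pow_const 2).aestronglyMeasurable
    (Eventually.of_forall fun ξ => ?_)
  rw [norm_pow, norm_norm]
  exact pow_le_pow_left₀ (norm_nonneg _) (norm_charFun_le ξ) 2

lemma integral_norm_charFun_sq_mul_gaussian {d : ℕ} (μ σ : Measure (EuclideanSpace ℝ (Fin d)))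
    [IsFiniteMeasure μ] [IsFiniteMeasure σ] (t : ℝ) {b : ℝ} (hb : 0 < b) :
    ∫ ξ, ‖charFun μ ξ‖ ^ 2 * ((charFun σ (t • ξ)).re * Real.exp (-b * ‖ξ‖ ^ 2)) =
      (Real.pi / b) ^ (d / 2 : ℝ) *
        ∫ z, Real.exp (-‖z‖ ^ 2 / (4 * b)) ∂(shiftedDifferenceLaw μ σ t) := by
  have h := congrArg Complex.re (integral_charFun_mul_gaussian (shiftedDifferenceLaw μ σ t) hb)
  rw [Complex.ofReal_re] at h
  have hint : Integrable fun ξ => charFun (shiftedDifferenceLaw μ σ t) ξ *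
      ((Real.exp (-b * ‖ξ‖ ^ 2) : ℝ) : ℂ) :=
    (integrable_exp_neg_mul_norm_sq hb).ofReal.bdd_mul
      (c := (shiftedDifferenceLaw μ σ t).real Set.univ)
      measurable_charFun.aestronglyMeasurable (Eventually.of_forall fun ξ => norm_charFun_le ξ)
  rw [← h]
  refine Eq.trans ?_ (integral_re hint)
  refine integral_congr_ae (Eventually.of_forall fun ξ => ?_)
  simp only [charFun_shiftedDifferenceLaw]
  change _ = Complex.re _
  rw [mul_assoc, Complex.re_ofReal_mul, Complex.re_mul_ofReal]

/-- Pointwise, `|μ̂|²` need not be monotone in `μ`. Its Gaussian average is, being the integral of a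
positive kernel in `x - y` against `μ × μ`; taking `t = 0` and `σ` a Dirac mass removes `σ̂` from
the identity. -/
lemma integral_norm_charFun_sq_mul_gaussian_mono {d : ℕ}
    {μ ν : Measure (EuclideanSpace ℝ (Fin d))} [IsFiniteMeasure μ] [IsFiniteMeasure ν]
    (hμν : μ ≤ ν) {b : ℝ} (hb : 0 < b) :
    ∫ ξ, ‖charFun μ ξ‖ ^ 2 * Real.exp (-b * ‖ξ‖ ^ 2) ≤
      ∫ ξ, ‖charFun ν ξ‖ ^ 2 * Real.exp (-b * ‖ξ‖ ^ 2) := by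
  have h : ∀ ρ : Measure (EuclideanSpace ℝ (Fin d)), IsFiniteMeasure ρ →
      ∫ ξ, ‖charFun ρ ξ‖ ^ 2 * Real.exp (-b * ‖ξ‖ ^ 2) = (Real.pi / b) ^ (d / 2 : ℝ) *
        ∫ z, Real.exp (-‖z‖ ^ 2 / (4 * b)) ∂(shiftedDifferenceLaw ρ (Measure.dirac 0) 0) := by
    intro ρ _
    rw [← integral_norm_charFun_sq_mul_gaussian ρ (Measure.dirac 0) 0 hb]
    simp
  rw [h μ inferInstance, h ν inferInstance]
  refine mul_le_mul_of_nonneg_left ?_ (by positivity)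
  refine integral_mono_measure (Measure.map_mono (by gcongr) (by fun_prop))
    (Eventually.of_forall fun z => (Real.exp_pos _).le) ?_
  refine Integrable.of_bound (by fun_prop) 1 (Eventually.of_forall fun z => ?_)
  rw [Real.norm_of_nonneg (Real.exp_pos _).le, Real.exp_le_one_iff]
  exact div_nonpos_of_nonpos_of_nonneg (neg_nonpos.mpr (sq_nonneg _)) (by positivity)

/-! ### Tails of functions with slowly growing ball integrals -/

/-- Cut into shells of ratio `64`, chosen so that `64^(1/6) = 2` and `64^(-1/3) = 1/4`: growth at
most `2` per shell against decay `1/4` leaves a geometric series of ratio `1/2`. -/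
lemma lintegral_compl_closedBall_mul_rpow_le {d : ℕ} {g : EuclideanSpace ℝ (Fin d) → ENNReal}
    (hg : Measurable g) {A a : ℝ} (hA : 0 ≤ A) (ha : a ≤ 1 / 6)
    (hF : ∀ T : ℝ, 1 ≤ T → ∫⁻ ξ in Metric.closedBall 0 T, g ξ ≤ ENNReal.ofReal (A * T ^ a))
    {R : ℝ} (hR : 1 ≤ R) :
    ∫⁻ ξ in (Metric.closedBall 0 R)ᶜ, g ξ * ENNReal.ofReal ((‖ξ‖ / R) ^ (-(1 / 3) : ℝ)) ≤
      ENNReal.ofReal (4 * A * R ^ a) := by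
  have hR0 : 0 < R := by linarith
  set f : ℕ → EuclideanSpace ℝ (Fin d) → ENNReal := fun k =>
    (Metric.closedBall 0 (64 ^ (k + 1) * R)).indicator
      fun ξ => g ξ * ENNReal.ofReal ((1 / 4) ^ k) with hf
  have hfm : ∀ k, Measurable (f k) := fun k =>
    (hg.mul_const _).indicator Metric.isClosed_closedBall.measurableSet
  have hpt : ∀ ξ ∈ (Metric.closedBall (0 : EuclideanSpace ℝ (Fin d)) R)ᶜ,
      g ξ * ENNReal.ofReal ((‖ξ‖ / R) ^ (-(1 / 3) : ℝ)) ≤ ∑' k, f k ξ := by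
    intro ξ hξ
    have hξR : R < ‖ξ‖ := by simpa using hξ
    obtain ⟨k, hk1, hk2⟩ := exists_nat_pow_near (x := ‖ξ‖ / R) (y := (64 : ℝ))
      ((one_le_div hR0).mpr hξR.le) (by norm_num)
    refine le_trans ?_ (ENNReal.le_tsum k)
    have hmem : ξ ∈ Metric.closedBall (0 : EuclideanSpace ℝ (Fin d)) (64 ^ (k + 1) * R) := by
      rw [mem_closedBall_zero_iff]
      exact ((div_lt_iff₀ hR0).mp hk2).le
    simp only [hf, Set.indicator_of_mem hmem]
    gcongr
    calc (‖ξ‖ / R) ^ (-(1 / 3) : ℝ) ≤ ((64 : ℝ) ^ k) ^ (-(1 / 3) : ℝ) :=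
          Real.rpow_le_rpow_of_nonpos (by positivity) hk1 (by norm_num)
      _ = ((64 : ℝ) ^ (-(1 / 3) : ℝ)) ^ k := by
          rw [← Real.rpow_natCast, ← Real.rpow_mul (by norm_num), mul_comm,
            Real.rpow_mul (by norm_num), Real.rpow_natCast]
      _ = (1 / 4) ^ k := by
          congr 1
          rw [show (64 : ℝ) = 4 ^ (3 : ℝ) by norm_num, ← Real.rpow_mul (by norm_num),
            show (3 : ℝ) * -(1 / 3) = -1 by norm_num, Real.rpow_neg_one]
          norm_num
  have hterm : ∀ k, ∫⁻ ξ, f k ξ ≤ ENNReal.ofReal (2 * A * R ^ a * (1 / 2) ^ k) := by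
    intro k
    have h64 : (1 : ℝ) ≤ 64 ^ (k + 1) := one_le_pow₀ (by norm_num)
    rw [lintegral_indicator Metric.isClosed_closedBall.measurableSet,
      lintegral_mul_const _ hg]
    refine (mul_le_mul_left (hF _ (one_le_mul_of_one_le_of_one_le h64 hR)) _).trans ?_
    rw [← ENNReal.ofReal_mul (by positivity)]
    refine ENNReal.ofReal_le_ofReal ?_
    have h2 : ((64 : ℝ) ^ (k + 1)) ^ a ≤ 2 ^ (k + 1) := by
      calc ((64 : ℝ) ^ (k + 1)) ^ a ≤ ((64 : ℝ) ^ (k + 1)) ^ (1 / 6 : ℝ) :=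
            Real.rpow_le_rpow_of_exponent_le h64 ha
        _ = 2 ^ (k + 1) := by
            rw [show (64 : ℝ) = 2 ^ 6 by norm_num, ← pow_mul, mul_comm, pow_mul,
              ← Real.rpow_natCast (_ ^ (k + 1)) 6, ← Real.rpow_mul (by positivity)]
            norm_num
    rw [Real.mul_rpow (by positivity) hR0.le]
    calc A * (((64 : ℝ) ^ (k + 1)) ^ a * R ^ a) * (1 / 4) ^ k
        ≤ A * (2 ^ (k + 1) * R ^ a) * (1 / 4) ^ k := by gcongr
      _ = 2 * A * R ^ a * (2 ^ k * (1 / 4) ^ k) := by ring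
      _ = 2 * A * R ^ a * (1 / 2) ^ k := by rw [← mul_pow]; norm_num
  calc _ ≤ ∫⁻ ξ in (Metric.closedBall 0 R)ᶜ, ∑' k, f k ξ :=
        setLIntegral_mono (Measurable.tsum hfm) hpt
    _ ≤ ∫⁻ ξ, ∑' k, f k ξ := setLIntegral_le_lintegral _ _
    _ = ∑' k, ∫⁻ ξ, f k ξ := lintegral_tsum fun k => (hfm k).aemeasurable
    _ ≤ ∑' k, ENNReal.ofReal (2 * A * R ^ a * (1 / 2) ^ k) := ENNReal.tsum_le_tsum hterm
    _ = ENNReal.ofReal (∑' k : ℕ, 2 * A * R ^ a * (1 / 2) ^ k) :=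
        (ENNReal.ofReal_tsum_of_nonneg (fun k => by positivity)
          (summable_geometric_two.mul_left _)).symm
    _ = ENNReal.ofReal (4 * A * R ^ a) := by
        rw [tsum_mul_left, tsum_geometric_two]; ring_nf

lemma integral_compl_closedBall_mul_rpow_le {d : ℕ} {g : EuclideanSpace ℝ (Fin d) → ℝ}
    (hg : Continuous g) (hg0 : ∀ ξ, 0 ≤ g ξ) {A a : ℝ} (hA : 0 ≤ A) (ha : a ≤ 1 / 6)
    (hF : ∀ T : ℝ, 1 ≤ T → ∫ ξ in Metric.closedBall 0 T, g ξ ≤ A * T ^ a)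
    {R : ℝ} (hR : 1 ≤ R) :
    IntegrableOn (fun ξ => g ξ * (‖ξ‖ / R) ^ (-(1 / 3) : ℝ)) (Metric.closedBall 0 R)ᶜ ∧
    ∫ ξ in (Metric.closedBall 0 R)ᶜ, g ξ * (‖ξ‖ / R) ^ (-(1 / 3) : ℝ) ≤ 4 * A * R ^ a := by
  have hR0 : 0 < R := by linarith
  have hnn : ∀ ξ : EuclideanSpace ℝ (Fin d), 0 ≤ g ξ * (‖ξ‖ / R) ^ (-(1 / 3) : ℝ) :=
    fun ξ => mul_nonneg (hg0 ξ) (by positivity)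
  have hm : Measurable fun ξ => g ξ * (‖ξ‖ / R) ^ (-(1 / 3) : ℝ) :=
    hg.measurable.mul ((measurable_norm.div_const R).pow_const _)
  have hl := lintegral_compl_closedBall_mul_rpow_le (g := fun ξ => ENNReal.ofReal (g ξ))
    (by fun_prop) hA ha (fun T hT => by
      rw [← ofReal_integral_eq_lintegral_ofReal
        (hg.continuousOn.integrableOn_compact (isCompact_closedBall 0 T))
        (Eventually.of_forall hg0)]
      exact ENNReal.ofReal_le_ofReal (hF T hT)) hR
  simp only [← ENNReal.ofReal_mul (hg0 _)] at hl
  have hi : IntegrableOn (fun ξ => g ξ * (‖ξ‖ / R) ^ (-(1 / 3) : ℝ)) (Metric.closedBall 0 R)ᶜ := by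
    refine ⟨hm.aestronglyMeasurable, ?_⟩
    rw [hasFiniteIntegral_iff_ofReal (Eventually.of_forall hnn)]
    exact hl.trans_lt ENNReal.ofReal_lt_top
  refine ⟨hi, ?_⟩
  rw [← ofReal_integral_eq_lintegral_ofReal hi (Eventually.of_forall hnn)] at hl
  exact (ENNReal.ofReal_le_ofReal_iff (by positivity)).mp hl

lemma continuous_norm_charFun_sq {d : ℕ} (μ : Measure (EuclideanSpace ℝ (Fin d)))
    [IsFiniteMeasure μ] : Continuous fun ξ => ‖charFun μ ξ‖ ^ 2 :=
  continuous_charFun.norm.pow 2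

/-- Growth of the partial `L²` Fourier integral passes to smaller measures. -/
lemma integral_closedBall_norm_charFun_sq_le_of_le {d : ℕ}
    {μ ν : Measure (EuclideanSpace ℝ (Fin d))} [IsFiniteMeasure μ] [IsFiniteMeasure ν]
    (hμν : μ ≤ ν) {A a : ℝ} (hA : 0 ≤ A) (ha : a ≤ 1 / 6)
    (hF : ∀ T : ℝ, 1 ≤ T → ∫ ξ in Metric.closedBall 0 T, ‖charFun ν ξ‖ ^ 2 ≤ A * T ^ a)
    {T : ℝ} (hT : 1 ≤ T) :
    ∫ ξ in Metric.closedBall 0 T, ‖charFun μ ξ‖ ^ 2 ≤ 15 * A * T ^ a := by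
  have hT0 : 0 < T := by linarith
  -- At this scale the Gaussian is at least `1/e ≥ 1/3` on the ball and below `(‖ξ‖ / T) ^ (-1/3)`
  -- outside it, whence `15 = 3 * (1 + 4)`.
  set b : ℝ := (T ^ 2)⁻¹ with hb
  have hb0 : 0 < b := by positivity
  have hbT : ∀ ξ : EuclideanSpace ℝ (Fin d), -b * ‖ξ‖ ^ 2 = -(‖ξ‖ / T) ^ 2 := fun ξ => by
    rw [hb]; field_simp
  have hms : MeasurableSet (Metric.closedBall (0 : EuclideanSpace ℝ (Fin d)) T) :=
    Metric.isClosed_closedBall.measurableSet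
  have hgi : ∀ ρ : Measure (EuclideanSpace ℝ (Fin d)), IsFiniteMeasure ρ →
      Integrable fun ξ => ‖charFun ρ ξ‖ ^ 2 * Real.exp (-b * ‖ξ‖ ^ 2) := fun ρ _ =>
    integrable_norm_charFun_sq_mul ρ (integrable_exp_neg_mul_norm_sq hb0)
  have hloc : ∀ ρ : Measure (EuclideanSpace ℝ (Fin d)), IsFiniteMeasure ρ →
      IntegrableOn (fun ξ => ‖charFun ρ ξ‖ ^ 2) (Metric.closedBall 0 T) := fun ρ _ =>
    (continuous_norm_charFun_sq ρ).continuousOn.integrableOn_compact (isCompact_closedBall 0 T)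
  obtain ⟨hti, htail⟩ := integral_compl_closedBall_mul_rpow_le (continuous_norm_charFun_sq ν)
    (fun ξ => sq_nonneg _) hA ha hF hT
  have h1 : ∫ ξ in Metric.closedBall 0 T, ‖charFun μ ξ‖ ^ 2 ≤
      3 * ∫ ξ, ‖charFun μ ξ‖ ^ 2 * Real.exp (-b * ‖ξ‖ ^ 2) := by
    rw [← integral_const_mul]
    refine le_trans ?_ (setIntegral_le_integral (s := Metric.closedBall 0 T)
      ((hgi μ inferInstance).const_mul 3)
      (Eventually.of_forall fun ξ => by positivity))
    refine setIntegral_mono_on (hloc μ inferInstance)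
      ((hgi μ inferInstance).const_mul 3).integrableOn hms fun ξ hξ => ?_
    have hξT : ‖ξ‖ / T ≤ 1 := (div_le_one hT0).mpr (by simpa using hξ)
    have h3 : 1 ≤ 3 * Real.exp (-b * ‖ξ‖ ^ 2) := by
      have h4 : Real.exp (-1) ≤ Real.exp (-b * ‖ξ‖ ^ 2) := by
        rw [Real.exp_le_exp, hbT]
        have : (‖ξ‖ / T) ^ 2 ≤ 1 := pow_le_one₀ (by positivity) hξT
        linarith
      have h5 : 1 ≤ 3 * Real.exp (-1) := by
        rw [Real.exp_neg, ← div_eq_mul_inv, one_le_div (Real.exp_pos _)]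
        linarith [Real.exp_one_lt_d9]
      linarith
    nlinarith [sq_nonneg ‖charFun μ ξ‖]
  have h2 : ∫ ξ, ‖charFun ν ξ‖ ^ 2 * Real.exp (-b * ‖ξ‖ ^ 2) ≤ A * T ^ a + 4 * A * T ^ a := by
    rw [← integral_add_compl hms (hgi ν inferInstance)]
    refine add_le_add ?_ ?_
    · refine le_trans (setIntegral_mono_on (hgi ν inferInstance).integrableOn
        (hloc ν inferInstance) hms fun ξ _ => ?_) (hF T hT)
      refine mul_le_of_le_one_right (sq_nonneg _) (Real.exp_le_one_iff.mpr ?_)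
      rw [hbT]
      exact neg_nonpos.mpr (sq_nonneg _)
    · refine le_trans (setIntegral_mono_on (hgi ν inferInstance).integrableOn hti hms.compl
        fun ξ hξ => ?_) htail
      have hξT : 1 ≤ ‖ξ‖ / T := (one_le_div hT0).mpr (by
        have : T < ‖ξ‖ := by simpa using hξ
        exact this.le)
      set u := ‖ξ‖ / T
      refine mul_le_mul_of_nonneg_left ?_ (sq_nonneg _)
      rw [hbT, Real.exp_neg, Real.rpow_neg (by positivity)]
      refine inv_anti₀ (by positivity) ?_
      calc u ^ (1 / 3 : ℝ) ≤ u ^ (1 : ℝ) := Real.rpow_le_rpow_of_exponent_le hξT (by norm_num)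
        _ = u := Real.rpow_one u
        _ ≤ u ^ 2 + 1 := by nlinarith
        _ ≤ Real.exp (u ^ 2) := Real.add_one_le_exp _
  have h3 := integral_norm_charFun_sq_mul_gaussian_mono hμν hb0
  linarith

/-! ### From Fourier integrals to distances -/

lemma half_le_re_charFun {d : ℕ} {σ : Measure (EuclideanSpace ℝ (Fin d))}
    [IsProbabilityMeasure σ] (hσ : ∀ᵐ x ∂σ, ‖x‖ = 1) {ξ : EuclideanSpace ℝ (Fin d)}
    (hξ : ‖ξ‖ ≤ 1) : 1 / 2 ≤ (charFun σ ξ).re := by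
  have hi : Integrable (fun x => Complex.exp ((inner ℝ x ξ : ℝ) * Complex.I)) σ :=
    integrable_cexp_mul_I (by fun_prop)
  have h1 : (charFun σ ξ).re = ∫ x, (Complex.exp ((inner ℝ x ξ : ℝ) * Complex.I)).re ∂σ := by
    rw [charFun_apply]
    exact (integral_re hi).symm
  have h2 : ∫ _, (1 / 2 : ℝ) ∂σ = 1 / 2 := by simp
  rw [h1, ← h2]
  refine integral_mono_ae (integrable_const _) hi.re ?_
  filter_upwards [hσ] with x hx
  rw [Complex.exp_ofReal_mul_I_re]
  have h3 : |inner ℝ x ξ| ≤ 1 := (abs_real_inner_le_norm x ξ).trans (by rw [hx, one_mul]; exact hξ)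
  have h4 : (inner ℝ x ξ : ℝ) ^ 2 ≤ 1 := (sq_le_one_iff_abs_le_one _).mpr h3
  linarith [Real.one_sub_sq_div_two_le_cos (x := inner ℝ x ξ)]

lemma isCompact_distanceSet {d : ℕ} {K : Set (EuclideanSpace ℝ (Fin d))} (hK : IsCompact K) :
    IsCompact (distanceSet K) := by
  have h : distanceSet K = (fun p : _ × _ => ‖p.1 - p.2‖) '' (K ×ˢ K) := by
    ext r
    simp only [distanceSet, Set.mem_ofPred_eq, Set.mem_image, Set.mem_prod, Prod.exists]
    constructor
    · rintro ⟨x, hx, y, hy, h⟩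
      exact ⟨x, y, ⟨hx, hy⟩, h⟩
    · rintro ⟨x, y, ⟨hx, hy⟩, h⟩
      exact ⟨x, hx, y, hy, h⟩
  rw [h]
  exact (hK.prod hK).image (by fun_prop)

lemma tendsto_rpow_mul_gaussian_tail (d : ℕ) {η : ℝ} (hη : 0 < η) :
    Tendsto (fun b : ℝ => (Real.pi / b) ^ (d / 2 : ℝ) * Real.exp (-η ^ 2 / (4 * b)))
      (𝓝[>] 0) (𝓝 0) := by
  have h := ((tendsto_rpow_mul_exp_neg_mul_atTop_nhds_zero (d / 2 : ℝ) (η ^ 2 / 4)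
    (by positivity)).comp tendsto_inv_nhdsGT_zero).const_mul (Real.pi ^ (d / 2 : ℝ))
  rw [mul_zero] at h
  refine h.congr' ?_
  filter_upwards [self_mem_nhdsWithin] with b hb
  have hb0 : (0 : ℝ) < b := hb
  simp only [Function.comp_apply]
  rw [div_eq_mul_inv Real.pi b, Real.mul_rpow Real.pi_pos.le (by positivity), mul_assoc]
  congr 3
  field_simp

/-- The distance set of a compact set is closed, so `t` is at some distance `η > 0` from it and `|x
- y + tω| ≥ η` almost surely. The Gaussian `exp (-η² / (4b))` then beats the normalising factor `b ^
(-d/2)`. -/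
lemma tendsto_integral_norm_charFun_sq_mul_gaussian {d : ℕ}
    {μ σ : Measure (EuclideanSpace ℝ (Fin d))} [IsFiniteMeasure μ] [IsFiniteMeasure σ]
    (hσ : ∀ᵐ x ∂σ, ‖x‖ = 1) {K : Set (EuclideanSpace ℝ (Fin d))} (hK : IsCompact K)
    (hμK : ∀ᵐ x ∂μ, x ∈ K) {t : ℝ} (ht : 0 ≤ t) (htK : t ∉ distanceSet K) :
    Tendsto (fun b : ℝ => ∫ ξ, ‖charFun μ ξ‖ ^ 2 *
      ((charFun σ (t • ξ)).re * Real.exp (-b * ‖ξ‖ ^ 2))) (𝓝[>] 0) (𝓝 0) := by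
  obtain ⟨η, hη, hball⟩ := Metric.isOpen_iff.mp (isCompact_distanceSet hK).isClosed.isOpen_compl
    t htK
  have hfar : ∀ᵐ z ∂(shiftedDifferenceLaw μ σ t), η ≤ ‖z‖ := by
    rw [shiftedDifferenceLaw, ae_map_iff (by fun_prop)
      (measurableSet_le measurable_const measurable_norm)]
    have h1 : ∀ᵐ p ∂(μ.prod (μ.prod σ)), p.1 ∈ K := Measure.quasiMeasurePreserving_fst.ae hμK
    have h2 : ∀ᵐ p ∂(μ.prod (μ.prod σ)), p.2.1 ∈ K :=
      Measure.quasiMeasurePreserving_snd.ae (Measure.quasiMeasurePreserving_fst.ae hμK)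
    have h3 : ∀ᵐ p ∂(μ.prod (μ.prod σ)), ‖p.2.2‖ = 1 :=
      Measure.quasiMeasurePreserving_snd.ae (Measure.quasiMeasurePreserving_snd.ae hσ)
    filter_upwards [h1, h2, h3] with p hp1 hp2 hp3
    by_contra! hlt
    refine hball (Metric.mem_ball.mpr ?_) ⟨p.1, hp1, p.2.1, hp2, rfl⟩
    rw [Real.dist_eq]
    refine lt_of_le_of_lt ?_ hlt
    have h4 := abs_norm_sub_norm_le (p.1 - p.2.1) (-(t • p.2.2))
    rwa [norm_neg, norm_smul, hp3, mul_one, Real.norm_of_nonneg ht, sub_neg_eq_add] at h4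
  have hlim := (tendsto_rpow_mul_gaussian_tail d hη).mul_const
    ((shiftedDifferenceLaw μ σ t).real Set.univ)
  rw [zero_mul] at hlim
  refine squeeze_zero' ?_ ?_ hlim
  · filter_upwards [self_mem_nhdsWithin] with b hb
    have hb0 : (0 : ℝ) < b := hb
    rw [integral_norm_charFun_sq_mul_gaussian μ σ t hb0]
    exact mul_nonneg (by positivity) (integral_nonneg fun z => (Real.exp_pos _).le)
  · filter_upwards [self_mem_nhdsWithin] with b hb
    have hb0 : (0 : ℝ) < b := hb
    rw [integral_norm_charFun_sq_mul_gaussian μ σ t hb0, mul_assoc]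
    refine mul_le_mul_of_nonneg_left ?_ (by positivity)
    refine (Real.le_norm_self _).trans (norm_integral_le_of_norm_le_const ?_)
    filter_upwards [hfar] with z hz
    rw [Real.norm_of_nonneg (Real.exp_pos _).le]
    gcongr

lemma abs_norm_charFun_sq_sub_le {d : ℕ} (μ : Measure (EuclideanSpace ℝ (Fin d)))
    [IsProbabilityMeasure μ] {K : Set (EuclideanSpace ℝ (Fin d))} (hK : MeasurableSet K)
    (ξ : EuclideanSpace ℝ (Fin d)) :
    |‖charFun μ ξ‖ ^ 2 - ‖charFun (μ.restrict K) ξ‖ ^ 2| ≤ 2 * μ.real Kᶜ := by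
  have hi : Integrable (fun x => Complex.exp ((inner ℝ x ξ : ℝ) * Complex.I)) μ :=
    integrable_cexp_mul_I (by fun_prop)
  have h1 : charFun μ ξ - charFun (μ.restrict K) ξ =
      ∫ x in Kᶜ, Complex.exp ((inner ℝ x ξ : ℝ) * Complex.I) ∂μ := by
    rw [charFun_apply, charFun_apply, ← integral_add_compl hK hi, add_sub_cancel_left]
  have h2 : ‖charFun μ ξ - charFun (μ.restrict K) ξ‖ ≤ μ.real Kᶜ := by
    rw [h1]
    refine (norm_setIntegral_le_of_norm_le_const (C := 1) (measure_lt_top _ _)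
      (fun x _ => (Complex.norm_exp_ofReal_mul_I _).le)).trans (by simp)
  have h3 : ‖charFun μ ξ‖ ≤ 1 := norm_charFun_le_one ξ
  have h4 : ‖charFun (μ.restrict K) ξ‖ ≤ 1 := by
    refine (norm_charFun_le ξ).trans ?_
    rw [measureReal_restrict_apply_univ]
    exact measureReal_le_one
  have h5 := (abs_norm_sub_norm_le (charFun μ ξ) (charFun (μ.restrict K) ξ)).trans h2
  rw [sq_sub_sq, abs_mul, abs_of_nonneg (by positivity)]
  have h6 : 0 ≤ μ.real Kᶜ := measureReal_nonneg
  exact mul_le_mul (by linarith) h5 (abs_nonneg _) (by norm_num)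

/-- If the `L²` mass of `μ̂` between the frequencies `1/t` and `M/t` is small compared to that
below `1/t`, then `t` is a distance of any set of full measure. -/
theorem mem_distanceSet_of_middle_frequencies_small {d : ℕ}
    {σ : Measure (EuclideanSpace ℝ (Fin d))} [IsProbabilityMeasure σ] (hσ : ∀ᵐ x ∂σ, ‖x‖ = 1)
    {B : ℝ} (hB : 0 ≤ B) (hdec : ∀ ξ, ξ ≠ 0 → ‖charFun σ ξ‖ ≤ B * ‖ξ‖ ^ (-(1 / 3) : ℝ))
    {C M : ℝ} (hC : 1 ≤ C) (hM : 1 ≤ M)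
    (hMB : B * M ^ (-(1 / 6) : ℝ) * (60 * C) ≤ C⁻¹ / 16)
    {a : ℝ} (ha : a ≤ 1 / 6)
    {μ : Measure (EuclideanSpace ℝ (Fin d))} [IsProbabilityMeasure μ]
    {E : Set (EuclideanSpace ℝ (Fin d))} (hE : MeasurableSet E) (hμE : μ Eᶜ = 0)
    (hup : ∀ T : ℝ, 1 ≤ T → ∫ ξ in Metric.closedBall 0 T, ‖charFun μ ξ‖ ^ 2 ≤ C * T ^ a)
    {t : ℝ} (ht : 0 < t) (ht1 : t ≤ 1)
    (hlow : C⁻¹ * (1 / t) ^ a ≤ ∫ ξ in Metric.closedBall 0 (1 / t), ‖charFun μ ξ‖ ^ 2)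
    (hmid : (∫ ξ in Metric.closedBall 0 (M / t), ‖charFun μ ξ‖ ^ 2) -
      ∫ ξ in Metric.closedBall 0 (1 / t), ‖charFun μ ξ‖ ^ 2 ≤ C⁻¹ / 16 * (1 / t) ^ a) :
    t ∈ distanceSet E := by
  set κ : ℝ := C⁻¹ * (1 / t) ^ a with hκ
  have hκ0 : 0 < κ := by positivity
  set r : ℝ := 1 / t with hr
  set R : ℝ := M / t with hRdef
  have hr0 : 0 < r := by positivity
  have hrR : r ≤ R := by rw [hr, hRdef]; gcongr
  have hR1 : 1 ≤ R := ((one_le_div ht).mpr ht1).trans hrR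
  have hR0 : 0 < R := by linarith
  set B₁ := Metric.closedBall (0 : EuclideanSpace ℝ (Fin d)) r with hB₁
  set B₂ := Metric.closedBall (0 : EuclideanSpace ℝ (Fin d)) R with hB₂
  have hB₁₂ : B₁ ⊆ B₂ := Metric.closedBall_subset_closedBall hrR
  have hB₁m : MeasurableSet B₁ := Metric.isClosed_closedBall.measurableSet
  have hB₂m : MeasurableSet B₂ := Metric.isClosed_closedBall.measurableSet
  have hB₂c : IsCompact B₂ := isCompact_closedBall 0 R
  set v : ℝ := volume.real B₂ with hv
  have hv0 : 0 ≤ v := measureReal_nonneg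
  -- Allowed to depend on `t` and `M`: removing mass `η` changes `|μ̂|²` by at most `2η` everywhere,
  -- hence its integral over `B₂` by at most `κ / 16`. Beyond `B₂` this comparison is useless, and
  -- the growth bound for smaller measures takes over.
  set η : ℝ := κ / (32 * (v + 1)) with hη
  have hη0 : 0 < η := by positivity
  have hηv : 2 * η * v ≤ κ / 16 := by
    have : η * (32 * (v + 1)) = κ := div_mul_cancel₀ _ (by positivity)
    nlinarith
  obtain ⟨K, hKE, hKc, hKlt⟩ := hE.exists_isCompact_lt_add (measure_ne_top μ E)
    (ε := ENNReal.ofReal η) (by simpa using hη0)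
  have hKm : MeasurableSet K := hKc.measurableSet
  have hKη : μ.real Kᶜ ≤ η := by
    have h1 : μ E = 1 := (prob_compl_eq_zero_iff hE).mp hμE
    have h2 : (1 : ℝ) ≤ μ.real K + η := by
      rw [h1] at hKlt
      have := ENNReal.toReal_mono (by finiteness) hKlt.le
      rwa [ENNReal.toReal_one, ENNReal.toReal_add (by finiteness) (by finiteness),
        ENNReal.toReal_ofReal hη0.le] at this
    rw [probReal_compl_eq_one_sub hKm]
    linarith
  obtain ⟨x, hx, y, hy, hxy⟩ : t ∈ distanceSet K := by
    by_contra htK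
    set μ' := μ.restrict K with hμ'
    set g : EuclideanSpace ℝ (Fin d) → ℝ := fun ξ => ‖charFun μ ξ‖ ^ 2 with hg
    set h : EuclideanSpace ℝ (Fin d) → ℝ := fun ξ => ‖charFun μ' ξ‖ ^ 2 with hh
    have hgc : Continuous g := continuous_norm_charFun_sq μ
    have hhc : Continuous h := continuous_norm_charFun_sq μ'
    have hh0 : ∀ ξ, 0 ≤ h ξ := fun ξ => sq_nonneg _
    have hgi : IntegrableOn g B₂ := hgc.continuousOn.integrableOn_compact hB₂c
    have hhi : IntegrableOn h B₂ := hhc.continuousOn.integrableOn_compact hB₂c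
    have hclose : ∀ S ⊆ B₂, |(∫ ξ in S, g ξ) - ∫ ξ in S, h ξ| ≤ κ / 16 := by
      intro S hS
      rw [← integral_sub (hgi.mono_set hS) (hhi.mono_set hS), ← Real.norm_eq_abs]
      have hfin : volume S < ⊤ := (measure_mono hS).trans_lt hB₂c.measure_lt_top
      refine (norm_setIntegral_le_of_norm_le_const (C := 2 * η) hfin fun ξ _ => ?_).trans ?_
      · exact (abs_norm_charFun_sq_sub_le μ hKm ξ).trans (by linarith)
      · refine le_trans ?_ hηv
        gcongr
        exact measureReal_mono hS hB₂c.measure_lt_top.ne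
    have hc1 := abs_le.mp (hclose B₁ hB₁₂)
    have hc2 := abs_le.mp (hclose (B₂ \ B₁) Set.sdiff_subset)
    have hgd : ∫ ξ in B₂ \ B₁, g ξ = (∫ ξ in B₂, g ξ) - ∫ ξ in B₁, g ξ :=
      setIntegral_sdiff hB₁m hgi hB₁₂
    obtain ⟨hti, htail⟩ := integral_compl_closedBall_mul_rpow_le hhc hh0
      (A := 15 * C) (by positivity) ha
      (fun T hT => integral_closedBall_norm_charFun_sq_le_of_le Measure.restrict_le_self
        (by positivity) ha hup hT) hR1
    -- The decay `M ^ (-1/3)` absorbs the growth `M ^ a ≤ M ^ (1/6)`.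
    have hhigh : B * M ^ (-(1 / 3) : ℝ) * (4 * (15 * C) * R ^ a) ≤ κ / 16 := by
      have e1 : R ^ a = M ^ a * r ^ a := by
        rw [← Real.mul_rpow (by positivity) hr0.le]; congr 1; rw [hRdef, hr]; ring
      have e2 : M ^ a ≤ M ^ (1 / 6 : ℝ) := Real.rpow_le_rpow_of_exponent_le hM ha
      have e3 : M ^ (-(1 / 3) : ℝ) * M ^ (1 / 6 : ℝ) = M ^ (-(1 / 6) : ℝ) := by
        rw [← Real.rpow_add (by positivity)]; norm_num
      calc B * M ^ (-(1 / 3) : ℝ) * (4 * (15 * C) * R ^ a)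
          = B * M ^ (-(1 / 3) : ℝ) * (60 * C) * r ^ a * M ^ a := by rw [e1]; ring
        _ ≤ B * M ^ (-(1 / 3) : ℝ) * (60 * C) * r ^ a * M ^ (1 / 6 : ℝ) := by gcongr
        _ = B * (M ^ (-(1 / 3) : ℝ) * M ^ (1 / 6 : ℝ)) * (60 * C) * r ^ a := by ring
        _ ≤ C⁻¹ / 16 * r ^ a := by rw [e3]; gcongr
        _ = κ / 16 := by rw [hκ]; ring
    -- In units of `κ / 64`: low frequencies give at least `15 = (64 - 4) / 4`, the middle range
    -- costs at most `4 + 4` (increment and approximation error), the high range at most `4`.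
    have hlower : ∀ᶠ b in 𝓝[>] (0 : ℝ), 3 / 64 * κ ≤
        ∫ ξ, h ξ * ((charFun σ (t • ξ)).re * Real.exp (-b * ‖ξ‖ ^ 2)) := by
      -- For such `b` the Gaussian is at least `1/2` on `‖ξ‖ ≤ 1/t`; with `Re σ̂ ≥ 1/2` this gives
      -- the factor `1/4` in `p1`.
      filter_upwards [Ioo_mem_nhdsGT (show (0 : ℝ) < t ^ 2 / 2 by positivity)] with b hb
      have hre : ∀ ξ, |(charFun σ (t • ξ)).re| ≤ 1 := fun ξ =>
        (Complex.abs_re_le_norm _).trans (norm_charFun_le_one _)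
      have hexp : ∀ ξ : EuclideanSpace ℝ (Fin d), Real.exp (-b * ‖ξ‖ ^ 2) ≤ 1 := fun ξ =>
        Real.exp_le_one_iff.mpr (by nlinarith [sq_nonneg ‖ξ‖, hb.1])
      have hwi : Integrable fun ξ : EuclideanSpace ℝ (Fin d) =>
          (charFun σ (t • ξ)).re * Real.exp (-b * ‖ξ‖ ^ 2) := by
        refine (integrable_exp_neg_mul_norm_sq hb.1).bdd_mul (c := 1) ?_
          (Eventually.of_forall hre)
        exact (Complex.continuous_re.comp
          (continuous_charFun.comp (continuous_const_smul t))).aestronglyMeasurable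
      have hi := integrable_norm_charFun_sq_mul μ' hwi
      rw [← integral_add_compl hB₂m hi]
      have hsplit := setIntegral_sdiff (μ := volume) hB₁m hi.integrableOn hB₁₂
      have p1 : 1 / 4 * ∫ ξ in B₁, h ξ ≤
          ∫ ξ in B₁, h ξ * ((charFun σ (t • ξ)).re * Real.exp (-b * ‖ξ‖ ^ 2)) := by
        rw [← integral_const_mul]
        refine setIntegral_mono_on ((hhi.mono_set hB₁₂).const_mul _) hi.integrableOn hB₁m
          fun ξ hξ => ?_
        have hξr : ‖ξ‖ ≤ r := by simpa [hB₁] using hξ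
        have q1 : 1 / 2 ≤ (charFun σ (t • ξ)).re := by
          refine half_le_re_charFun hσ ?_
          rw [norm_smul, Real.norm_of_nonneg ht.le]
          calc t * ‖ξ‖ ≤ t * r := by gcongr
            _ = 1 := by rw [hr]; field_simp
        have q2 : 1 / 2 ≤ Real.exp (-b * ‖ξ‖ ^ 2) := by
          refine le_trans ?_ (Real.add_one_le_exp _)
          have : b * ‖ξ‖ ^ 2 ≤ t ^ 2 / 2 * r ^ 2 := by
            have := hb.1; have := hb.2.le; gcongr
          have e : t ^ 2 / 2 * r ^ 2 = 1 / 2 := by rw [hr]; field_simp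
          linarith
        rw [mul_comm]
        refine mul_le_mul_of_nonneg_left ?_ (hh0 ξ)
        nlinarith
      have p2 : -∫ ξ in B₂ \ B₁, h ξ ≤
          ∫ ξ in B₂ \ B₁, h ξ * ((charFun σ (t • ξ)).re * Real.exp (-b * ‖ξ‖ ^ 2)) := by
        rw [← integral_neg]
        refine setIntegral_mono_on (hhi.mono_set Set.sdiff_subset).neg hi.integrableOn
          (hB₂m.diff hB₁m) fun ξ _ => ?_
        have q1 := abs_le.mp (hre ξ)
        have q2 := hexp ξ
        have q3 := Real.exp_pos (-b * ‖ξ‖ ^ 2)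
        have q4 : -1 ≤ (charFun σ (t • ξ)).re * Real.exp (-b * ‖ξ‖ ^ 2) := by nlinarith
        have := mul_le_mul_of_nonneg_left q4 (hh0 ξ)
        simpa using this
      have p3 : -(B * M ^ (-(1 / 3) : ℝ) *
            ∫ ξ in B₂ᶜ, h ξ * (‖ξ‖ / R) ^ (-(1 / 3) : ℝ)) ≤
          ∫ ξ in B₂ᶜ, h ξ * ((charFun σ (t • ξ)).re * Real.exp (-b * ‖ξ‖ ^ 2)) := by
        rw [← integral_const_mul, ← integral_neg]
        refine setIntegral_mono_on (hti.const_mul _).neg hi.integrableOn hB₂m.compl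
          fun ξ hξ => ?_
        have hξR : R < ‖ξ‖ := by simpa [hB₂] using hξ
        have hξ0 : 0 < ‖ξ‖ := hR0.trans hξR
        have q1 : |(charFun σ (t • ξ)).re| ≤
            B * (M ^ (-(1 / 3) : ℝ) * (‖ξ‖ / R) ^ (-(1 / 3) : ℝ)) := by
          refine (Complex.abs_re_le_norm _).trans ((hdec _ ?_).trans (le_of_eq ?_))
          · exact smul_ne_zero ht.ne' (norm_pos_iff.mp hξ0)
          · rw [← Real.mul_rpow (by positivity) (by positivity), norm_smul,
              Real.norm_of_nonneg ht.le]
            congr 2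
            rw [hRdef]; field_simp
        have q2 := hexp ξ
        have q3 := Real.exp_pos (-b * ‖ξ‖ ^ 2)
        have q4 : |(charFun σ (t • ξ)).re * Real.exp (-b * ‖ξ‖ ^ 2)| ≤
            B * (M ^ (-(1 / 3) : ℝ) * (‖ξ‖ / R) ^ (-(1 / 3) : ℝ)) := by
          rw [abs_mul, abs_of_pos q3]
          exact (mul_le_of_le_one_right (abs_nonneg _) q2).trans q1
        have := mul_le_mul_of_nonneg_left (neg_le_of_abs_le q4) (hh0 ξ)
        refine le_trans (le_of_eq ?_) this
        ring
      have p4 : B * M ^ (-(1 / 3) : ℝ) * ∫ ξ in B₂ᶜ, h ξ * (‖ξ‖ / R) ^ (-(1 / 3) : ℝ) ≤ κ / 16 :=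
        le_trans (by gcongr) hhigh
      have hmid' : (∫ ξ in B₂, g ξ) - ∫ ξ in B₁, g ξ ≤ κ / 16 :=
        hmid.trans (le_of_eq (by rw [hκ]; ring))
      have hlow' : κ ≤ ∫ ξ in B₁, g ξ := hlow
      change _ ≤ (∫ ξ in B₂, h ξ * ((charFun σ (t • ξ)).re * Real.exp (-b * ‖ξ‖ ^ 2))) + _
      linarith [hsplit, hc1.1, hc1.2, hc2.1, hc2.2]
    have hlim := tendsto_integral_norm_charFun_sq_mul_gaussian (μ := μ') hσ hKc
      (ae_restrict_mem hKm) ht.le htK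
    have := ge_of_tendsto hlim hlower
    linarith
  exact ⟨x, hKE hx, y, hKE hy, hxy⟩

/-! ### Lacunary sequences -/

lemma IsLacunary.pow_mul_le {τ₁ τ₂ : ℝ} {J : ℕ} {t : ℕ → ℝ} (ht : IsLacunary τ₁ τ₂ J t)
    (hτ₁ : 0 ≤ τ₁) {j : ℕ} (hj : 1 ≤ j) (n : ℕ) (hn : j + n ≤ J) :
    τ₁ ^ n * t j ≤ t (j + n) := by
  induction n with
  | zero => simp
  | succ n ih =>
    have h1 := (ht.1 (j + n) (by omega) (by exact_mod_cast (by omega : j + n ≤ J))).1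
    have h2 := (ht.2 (j + n) (by omega) (by exact_mod_cast hn)).1
    rw [le_div_iff₀ h1] at h2
    calc τ₁ ^ (n + 1) * t j = τ₁ * (τ₁ ^ n * t j) := by ring
      _ ≤ τ₁ * t (j + n) := by gcongr; exact ih (by omega)
      _ ≤ _ := h2

lemma IsLacunary.le_pow_mul {τ₁ τ₂ : ℝ} {J : ℕ} {t : ℕ → ℝ} (ht : IsLacunary τ₁ τ₂ J t)
    (hτ₂ : 0 ≤ τ₂) {j : ℕ} (hj : 1 ≤ j) (n : ℕ) (hn : j + n ≤ J) :
    t (j + n) ≤ τ₂ ^ n * t j := by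
  induction n with
  | zero => simp
  | succ n ih =>
    have h1 := (ht.1 (j + n) (by omega) (by exact_mod_cast (by omega : j + n ≤ J))).1
    have h2 := (ht.2 (j + n) (by omega) (by exact_mod_cast hn)).2
    rw [div_le_iff₀ h1] at h2
    calc t (j + (n + 1)) ≤ τ₂ * t (j + n) := h2
      _ ≤ τ₂ * (τ₂ ^ n * t j) := by gcongr; exact ih (by omega)
      _ = τ₂ ^ (n + 1) * t j := by ring

lemma IsLacunary.shift {τ₁ τ₂ : ℝ} {t : ℕ → ℝ} (ht : IsLacunary τ₁ τ₂ ⊤ t) (k J : ℕ) :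
    IsLacunary τ₁ τ₂ J fun j => t (k + j) :=
  ⟨fun j hj _ => ht.1 (k + j) (by omega) le_top,
    fun j hj _ => ht.2 (k + j) (by omega) le_top⟩

/-- A slowly growing monotone function has a small increment between `1/t` and `M/t` for some term
`t` of any sufficiently long lacunary sequence. -/
lemma IsLacunary.exists_small_increment {τ₁ τ₂ : ℝ} (hτ₁ : 0 < τ₁) (hτ : τ₁ ≤ τ₂) (hτ₂ : τ₂ < 1)
    {C M c a : ℝ} (hM : 0 < M) (hc : 0 < c) (ha : 0 ≤ a) {N L : ℕ} (hN : τ₂ ^ N ≤ M⁻¹)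
    (hL : C / (c * τ₁) < L) (haNL : (L * N : ℕ) * a ≤ 1)
    {F : ℝ → ℝ} (hF : Monotone F) (hF0 : ∀ T, 0 ≤ F T) (hFC : ∀ T, 1 ≤ T → F T ≤ C * T ^ a)
    {t : ℕ → ℝ} (ht : IsLacunary τ₁ τ₂ (L * N + 1 : ℕ) t) :
    ∃ j ∈ Set.Icc 1 (L * N + 1), F (M / t j) - F (1 / t j) ≤ c * (1 / t j) ^ a := by
  by_contra! hcon
  have hτ₂0 : 0 ≤ τ₂ := hτ₁.le.trans hτ
  -- Keeping every `N`-th term makes consecutive ratios at most `1/M`, so the ranges `[1 / u l, M /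
  -- u l]` do not overlap.
  set u : ℕ → ℝ := fun l => t (1 + l * N) with hu
  have hidx : ∀ l ≤ L, 1 + l * N ≤ L * N + 1 := fun l hl => by
    have := Nat.mul_le_mul_right N hl; omega
  have hupos : ∀ l ≤ L, 0 < u l ∧ u l ≤ 1 := fun l hl =>
    ht.1 _ (by omega) (by exact_mod_cast hidx l hl)
  have hL0 := hupos L le_rfl
  have hstep : ∀ l < L, c * τ₁ * (1 / u L) ^ a ≤ F (1 / u (l + 1)) - F (1 / u l) := by
    intro l hl
    have hl0 := hupos l hl.le
    have h1 : u (l + 1) ≤ M⁻¹ * u l := by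
      have h := ht.le_pow_mul hτ₂0 (j := 1 + l * N) (by omega) N
        (by have := hidx (l + 1) hl; rw [add_mul] at this; omega)
      have e : u (l + 1) = t (1 + l * N + N) := by simp only [hu]; congr 1; ring
      rw [e]
      exact h.trans (mul_le_mul_of_nonneg_right hN hl0.1.le)
    have h2 : M / u l ≤ 1 / u (l + 1) := by
      rw [div_le_div_iff₀ hl0.1 (hupos (l + 1) hl).1]
      calc M * u (l + 1) ≤ M * (M⁻¹ * u l) := by gcongr
        _ = 1 * u l := by field_simp
    have h3 : τ₁ ^ ((L - l) * N) * u l ≤ u L := by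
      have e : 1 + l * N + (L - l) * N = 1 + L * N := by
        rw [add_assoc, ← add_mul]; congr 2; omega
      have h := ht.pow_mul_le hτ₁.le (j := 1 + l * N) (by omega) ((L - l) * N) (by rw [e]; omega)
      rwa [e] at h
    -- Since `L N a ≤ 1`, the power `(1/t) ^ a` varies by at most a factor `1/τ₁` over the whole
    -- block, so every increment is comparable to the final growth bound.
    have h4 : τ₁ * (1 / u L) ^ a ≤ (1 / u l) ^ a := by
      have e1 : τ₁ ≤ (τ₁ ^ ((L - l) * N)) ^ a := by
        rw [← Real.rpow_natCast, ← Real.rpow_mul hτ₁.le]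
        conv_lhs => rw [← Real.rpow_one τ₁]
        refine Real.rpow_le_rpow_of_exponent_ge hτ₁ (hτ.trans hτ₂.le) (le_trans ?_ haNL)
        gcongr
        omega
      calc τ₁ * (1 / u L) ^ a ≤ (τ₁ ^ ((L - l) * N)) ^ a * (1 / u L) ^ a := by
            have := hL0.1; gcongr
        _ = (τ₁ ^ ((L - l) * N) * (1 / u L)) ^ a :=
            (Real.mul_rpow (by positivity) (one_div_nonneg.mpr hL0.1.le)).symm
        _ ≤ (1 / u l) ^ a := by
            refine Real.rpow_le_rpow (mul_nonneg (by positivity) (one_div_nonneg.mpr hL0.1.le))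
              ?_ ha
            rw [mul_one_div, div_le_div_iff₀ hL0.1 hl0.1, one_mul]
            exact h3
    have h5 := hcon (1 + l * N) ⟨by omega, hidx l hl.le⟩
    have h6 := hF h2
    change c * (1 / u l) ^ a < F (M / u l) - F (1 / u l) at h5
    nlinarith
  -- Telescoping gives `F (1 / u L) ≥ L c τ₁ (1 / u L) ^ a`, contradicting the upper bound because
  -- `L c τ₁ > C`.
  have hsum := Finset.sum_le_sum fun l hl => hstep l (Finset.mem_range.mp hl)
  rw [Finset.sum_range_sub (fun l => F (1 / u l)) L, Finset.sum_const, Finset.card_range,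
    nsmul_eq_mul] at hsum
  have h7 := hFC (1 / u L) ((one_le_div hL0.1).mpr hL0.2)
  have h8 := hF0 (1 / u 0)
  have hpos : 0 < (1 / u L) ^ a := Real.rpow_pos_of_pos (one_div_pos.mpr hL0.1) _
  rw [div_lt_iff₀ (by positivity)] at hL
  nlinarith

/-! ### Partial Fourier integrals -/

lemma norm_fourierMeasure {d : ℕ} (μ : Measure (EuclideanSpace ℝ (Fin d)))
    (ξ : EuclideanSpace ℝ (Fin d)) : ‖fourierMeasure μ ξ‖ = ‖charFun μ ξ‖ := by
  have h : fourierMeasure μ ξ = charFun μ (-ξ) := by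
    rw [fourierMeasure, charFun_apply]
    refine integral_congr_ae (Eventually.of_forall fun x => ?_)
    simp only [inner_neg_right, Complex.ofReal_neg, neg_mul]
    rw [mul_comm]
  rw [h, charFun_neg, RCLike.norm_conj]

lemma partialFourierIntegral_eq {d : ℕ} (μ : Measure (EuclideanSpace ℝ (Fin d))) (T : ℝ) :
    partialFourierIntegral μ T = ∫ ξ in Metric.closedBall 0 T, ‖charFun μ ξ‖ ^ 2 := by
  simp only [partialFourierIntegral, norm_fourierMeasure]

lemma partialFourierIntegral_nonneg {d : ℕ} (μ : Measure (EuclideanSpace ℝ (Fin d))) (T : ℝ) :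
    0 ≤ partialFourierIntegral μ T :=
  integral_nonneg fun _ => sq_nonneg _

lemma monotone_partialFourierIntegral {d : ℕ} (μ : Measure (EuclideanSpace ℝ (Fin d)))
    [IsFiniteMeasure μ] : Monotone (partialFourierIntegral μ) := by
  intro S T hST
  rw [partialFourierIntegral_eq, partialFourierIntegral_eq]
  exact setIntegral_mono_set
    ((continuous_norm_charFun_sq μ).continuousOn.integrableOn_compact (isCompact_closedBall 0 T))
    (Eventually.of_forall fun ξ => sq_nonneg _)
    (Metric.closedBall_subset_closedBall hST).eventuallyLE

theorem theorem1p6 (d : ℕ) (hd : 2 ≤ d) (C₀ : ℝ) (hC₀ : 1 ≤ C₀)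
    (τ₁ τ₂ : ℝ) (hτ₁ : 0 < τ₁) (hτ : τ₁ ≤ τ₂) (hτ₂ : τ₂ < 1) :
    ∃ (ε₀ : ℝ) (J₀ : ℕ), 0 < ε₀ ∧ ε₀ < 1 ∧ 1 ≤ J₀ ∧
      ∀ (s : ℝ), (d : ℝ) - ε₀ < s → s < d →
      ∀ (E : Set (EuclideanSpace ℝ (Fin d))), MeasurableSet E → E ⊆ unitCube d →
        IsQuasiRegular s E →
      ∀ (μ : Measure (EuclideanSpace ℝ (Fin d))), IsProbabilityMeasure μ → μ Eᶜ = 0 →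
        IsLocallyUniformlyDimensional s μ →
        (∀ T : ℝ, 1 ≤ T →
          C₀⁻¹ * T ^ ((d : ℝ) - s) ≤ partialFourierIntegral μ T ∧
            partialFourierIntegral μ T ≤ C₀ * T ^ ((d : ℝ) - s)) →
        (∀ t : ℕ → ℝ, IsLacunary τ₁ τ₂ J₀ t →
          1 ≤ (distanceSet E ∩ t '' Set.Icc 1 J₀).encard) ∧
        (∀ t : ℕ → ℝ, IsLacunary τ₁ τ₂ ⊤ t →
          ∀ k : ℕ, ∃ j ∈ Set.Icc (k + 1) (k + J₀), t j ∈ distanceSet E) := by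
  obtain ⟨σ, hσp, hσ, B, hB, hdec⟩ := exists_sphere_measure_charFun_decay hd
  have hτ₂0 : 0 < τ₂ := hτ₁.trans_le hτ
  set c : ℝ := C₀⁻¹ / 16 with hc
  have hc0 : 0 < c := by positivity
  obtain ⟨M, hM, hMB⟩ : ∃ M : ℝ, 1 ≤ M ∧ B * M ^ (-(1 / 6) : ℝ) * (60 * C₀) ≤ c := by
    have h := ((tendsto_rpow_neg_atTop (show (0 : ℝ) < 1 / 6 by norm_num)).const_mul B).mul_const
      (60 * C₀)
    rw [mul_zero, zero_mul] at h
    exact ((eventually_ge_atTop 1).and (h.eventually_le_const hc0)).exists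
  have hM0 : 0 < M := by linarith
  obtain ⟨N, hN⟩ := exists_pow_lt_of_lt_one (inv_pos.mpr hM0) hτ₂
  obtain ⟨L, hL⟩ := exists_nat_gt (C₀ / (c * τ₁))
  set n : ℕ := L * N with hn
  have hn1 : (0 : ℝ) < n + 6 := by positivity
  -- With this `ε₀`, `a = d - s` satisfies both `a ≤ 1/6`, for the high frequency tail, and `n a ≤
  -- 1`, for the pigeonhole. The sparse subsequence uses indices `1, 1 + N, …, 1 + L N`, hence `n +
  -- 1` terms.
  refine ⟨1 / (n + 6), n + 1, by positivity, ?_, by omega, ?_⟩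
  · rw [div_lt_one hn1]
    linarith [(Nat.cast_nonneg n : (0 : ℝ) ≤ n)]
  intro s hs1 hs2 E hE _ _ μ hμ hμE _ hF
  set a : ℝ := d - s with ha
  have ha0 : 0 ≤ a := by linarith
  have han : a * (n + 6) ≤ 1 := by
    rw [← le_div_iff₀ hn1]; linarith
  have hna : (0 : ℝ) ≤ n * a := by positivity
  have ha6 : a ≤ 1 / 6 := by linarith
  have key : ∀ t : ℕ → ℝ, IsLacunary τ₁ τ₂ (n + 1 : ℕ) t →
      ∃ j ∈ Set.Icc 1 (n + 1), t j ∈ distanceSet E := by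
    intro t ht
    obtain ⟨j, hj, hinc⟩ := ht.exists_small_increment hτ₁ hτ hτ₂ hM0 hc0 ha0 hN.le hL
      (by linarith) (monotone_partialFourierIntegral μ) (partialFourierIntegral_nonneg μ)
      (fun T hT => (hF T hT).2)
    have htj := ht.1 j hj.1 (by exact_mod_cast hj.2)
    refine ⟨j, hj, mem_distanceSet_of_middle_frequencies_small hσ hB hdec hC₀ hM hMB ha6 hE hμE
      (fun T hT => ?_) htj.1 htj.2 ?_ ?_⟩
    · rw [← partialFourierIntegral_eq]
      exact (hF T hT).2
    · rw [← partialFourierIntegral_eq]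
      exact (hF _ ((one_le_div htj.1).mpr htj.2)).1
    · rw [← partialFourierIntegral_eq, ← partialFourierIntegral_eq]
      exact hinc
  refine ⟨fun t ht => ?_, fun t ht k => ?_⟩
  · obtain ⟨j, hj, htj⟩ := key t ht
    exact Set.one_le_encard_iff_nonempty.mpr ⟨t j, htj, j, hj, rfl⟩
  · obtain ⟨j, hj, htj⟩ := key _ (ht.shift k (n + 1))
    exact ⟨k + j, ⟨by have := hj.1; omega, by have := hj.2; omega⟩, htj⟩
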